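/- Let $\alpha,\beta\in\mathbb C$ with $|\alpha|\ge|\beta|>1$, fix logarithms $\log\alpha,\log\beta$ (any $a,b\in\mathbb C$ with $e^a=\alpha$, $e^b=\beta$) and put $\log(\alpha/\beta):=\log\alpha-\log\beta$. Let $S^3=\{(\xi_1,\xi_2)\in\mathbb C^2:|\xi_1|^2+|\xi_2|^2=1\}$ and $S^1=\mathbb R/2\pi\mathbb Z$. On $S^1\times S^3$ use the frame $$e_1=\partial_\theta,\quad e_2=(i\xi_1,i\xi_2),\quad e_3=(-\bar\xi_2,\bar\xi_1),\quad e_4=(-i\bar\xi_2,i\bar\xi_1),$$ and put $G=|\xi_1|^2\log\alpha+|\xi_2|^2\log\beta$. Let $J_{\alpha,\beta}$ be the complex structure on $S^1\times S^3$ transferred from the Hopf surface $(\mathbb C^2\setminus 0)/\langle (z_1,z_2)\mapsto(\alpha z_1,\beta z_2)\rangle$ by the diffeomorphism $(\theta,(\xi_1,\xi_2))\mapsto[e^{\theta\log\alpha/2\pi}\xi_1,\,e^{\theta\log\beta/2\pi}\xi_2]$; explicitly $$J e_1=-\tfrac{\Im G}{\Re G}e_1+\tfrac{|G|^2}{2\pi\Re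 G}e_2-\tfrac{\Re(i\xi_1\xi_2\overline G\log(\alpha/\beta))}{2\pi\Re G}e_3-\tfrac{\Im(i\xi_1\xi_2\overline G\log(\alpha/\beta))}{2\pi\Re G}e_4,$$ $$J e_2=-\tfrac{2\pi}{\Re G}e_1+\tfrac{\Im G}{\Re G}e_2-\tfrac{\Re(\xi_1\xi_2\log(\alpha/\beta))}{\Re G}e_3-\tfrac{\Im(\xi_1\xi_2\log(\alpha/\beta))}{\Re G}e_4,\qquad J e_3=e_4,\qquad J e_4=-e_3.$$ Let $h:\mathbb R\to\mathbb R$ be smooth, positive and $2\pi$-periodic, regarded as a function of $\theta\in S^1$, and let $g^h_{\alpha,\beta}$ be the real part of the Hermitian form (complex linear in the first variable) on $T(S^1\times S^3)$ whose matrix in the $J_{\alpha,\beta}$-complex basis $(e_2,e_3)$ is $$\begin{pmatrix}\dfrac{\pi h}{(\Re G)^2}+\dfrac{|\xi_1|^2|\xi_2|^2\log^2(|\alpha|/|\beta|)}{(\Re G)^3} & \dfrac{i\xi_1\xi_2\log(|\alpha|/|\beta|)}{(\Re G)^2}\\[2ex] \dfrac{\overline{i\xi_1\xi_2}\log(|\alpha|/|\beta|)}{(\Re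 G)^2} & \dfrac{1}{\Re G}\end{pmatrix}.$$ A Hermitian manifold $(M,J,g)$ is locally conformally Kähler (l.c.K.) if every point has an open neighbourhood $U$ and a smooth $f:U\to\mathbb R$ such that $e^{-f}g|_U$ is Kähler; its Lee form is the $1$-form $\omega$ with $\omega|_U=df$ for all such $U$, $f$. It is Vaisman if it is l.c.K. and its Lee form is parallel for the Levi-Civita connection of $g$. Theorem. $(S^1\times S^3,J_{\alpha,\beta},g^h_{\alpha,\beta})$ is an l.c.K. manifold, and it is Vaisman if and only if $h$ is constant. -/

import Mathlib

open scoped Manifold ContDiff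

noncomputable section

namespace LCK

/-! ## Hermitian, Kähler, locally conformally Kähler and Vaisman structures on a manifold -/

section General

variable {E : Type*} [NormedAddCommGroup E] [NormedSpace ℝ E] [FiniteDimensional ℝ E]
  {H : Type*} [TopologicalSpace H] (I : ModelWithCorners ℝ E H)
  {M : Type*} [TopologicalSpace M] [ChartedSpace H M] [IsManifold I ∞ M]

/-- Smoothness of a vector field on `M`. -/
def IsSmoothField (X : Π x : M, TangentSpace I x) : Prop :=
  ContMDiff I I.tangent ∞ (fun x ↦ (⟨x, X x⟩ : TangentBundle I M))

/-- The exterior derivative of a `2`-form `Ω`, evaluated on three vector fields at a point: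
`dΩ(X,Y,Z) = X Ω(Y,Z) + Y Ω(Z,X) + Z Ω(X,Y) - Ω([X,Y],Z) - Ω([Y,Z],X) - Ω([Z,X],Y)`. -/
def extDerivTwo (Ω : Π x : M, TangentSpace I x → TangentSpace I x → ℝ)
    (X Y Z : Π x : M, TangentSpace I x) (x : M) : ℝ :=
  mvfderiv I (fun y ↦ Ω y (Y y) (Z y)) x (X x)
    + mvfderiv I (fun y ↦ Ω y (Z y) (X y)) x (Y x)
    + mvfderiv I (fun y ↦ Ω y (X y) (Y y)) x (Z x)
    - Ω x (VectorField.mlieBracket I X Y x) (Z x)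
    - Ω x (VectorField.mlieBracket I Y Z x) (X x)
    - Ω x (VectorField.mlieBracket I Z X x) (Y x)

/-- The `2`-form `Ω` satisfies `dΩ = 0` at every point of `U`. -/
def IsClosedTwoFormOn
    (Ω : Π x : M, TangentSpace I x → TangentSpace I x → ℝ) (U : Set M) : Prop :=
  ∀ X Y Z : Π x : M, TangentSpace I x,
    IsSmoothField I X → IsSmoothField I Y → IsSmoothField I Z →
      ∀ x ∈ U, extDerivTwo I Ω X Y Z x = 0

/-- `J` is a complex structure of complex dimension `n` on `M`: around every point there are
smooth local coordinates `φ` with values in `ℂⁿ` that are holomorphic for `J`, that is, `dφ` is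
bijective and `dφ (J v) = i dφ v`. (In particular `J` is smooth and `J² = -1`, and the changes of
such coordinates are holomorphic.) -/
def IsComplexStructure (n : ℕ) (J : Π x : M, TangentSpace I x → TangentSpace I x) : Prop :=
  ∀ p : M, ∃ U : Set M, IsOpen U ∧ p ∈ U ∧ ∃ φ : M → (Fin n → ℂ),
    ContMDiffOn I 𝓘(ℝ, Fin n → ℂ) ∞ φ U ∧
    ∀ x ∈ U, Function.Bijective (mvfderiv I φ x) ∧
      ∀ v : TangentSpace I x, mvfderiv I φ x (J x v) = Complex.I • mvfderiv I φ x v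

/-- `g` is a smooth Riemannian metric on `M`. -/
def IsRiemannianMetric
    (g : Π x : M, TangentSpace I x → TangentSpace I x → ℝ) : Prop :=
  ∃ G : Bundle.ContMDiffRiemannianMetric I ∞ E (fun x : M ↦ TangentSpace I x),
    ∀ (x : M) (v w : TangentSpace I x), G.inner x v w = g x v w

/-- `(M, J, g)` is a Hermitian manifold of complex dimension `n`. -/
structure IsHermitianManifold (n : ℕ)
    (J : Π x : M, TangentSpace I x → TangentSpace I x)
    (g : Π x : M, TangentSpace I x → TangentSpace I x → ℝ) : Prop where
  complexStructure : IsComplexStructure I n J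
  riemannian : IsRiemannianMetric I g
  compatible : ∀ (x : M) (v w : TangentSpace I x), g x (J x v) (J x w) = g x v w

/-- The fundamental form `Ω(v,w) = g(Jv,w)`, equivalently `g(v,w) = -Ω(Jv,w)`. -/
def fundamentalForm (J : Π x : M, TangentSpace I x → TangentSpace I x)
    (g : Π x : M, TangentSpace I x → TangentSpace I x → ℝ) :
    Π x : M, TangentSpace I x → TangentSpace I x → ℝ :=
  fun x v w ↦ g x (J x v) w

/-- For `(M, J, g)` Hermitian: `f` is smooth on the open set `U`, and the Hermitian metric
`e^{-f} g` is Kähler on `U`. -/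
def IsLocalConformalFactor
    (J : Π x : M, TangentSpace I x → TangentSpace I x)
    (g : Π x : M, TangentSpace I x → TangentSpace I x → ℝ) (U : Set M) (f : M → ℝ) : Prop :=
  IsOpen U ∧ ContMDiffOn I 𝓘(ℝ, ℝ) ∞ f U ∧
    IsClosedTwoFormOn I (fundamentalForm I J (fun x v w ↦ Real.exp (-f x) * g x v w)) U

/-- `(M, J, g)` is a locally conformally Kähler manifold of complex dimension `n`. -/
def IsLCK (n : ℕ) (J : Π x : M, TangentSpace I x → TangentSpace I x)
    (g : Π x : M, TangentSpace I x → TangentSpace I x → ℝ) : Prop :=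
  IsHermitianManifold I n J g ∧
    ∀ p : M, ∃ (U : Set M) (f : M → ℝ), p ∈ U ∧ IsLocalConformalFactor I J g U f

/-- `η` is the Lee form of the l.c.K. manifold `(M, J, g)`: locally `η = df` where `e^{-f} g` is
Kähler. -/
def IsLeeForm (J : Π x : M, TangentSpace I x → TangentSpace I x)
    (g : Π x : M, TangentSpace I x → TangentSpace I x → ℝ)
    (η : Π x : M, TangentSpace I x →L[ℝ] ℝ) : Prop :=
  ∀ p : M, ∃ (U : Set M) (f : M → ℝ), p ∈ U ∧ IsLocalConformalFactor I J g U f ∧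
    ∀ x ∈ U, η x = mvfderiv I f x

/-- `nabla` is the Levi-Civita connection of `g`: torsion-free, and
`X g(Y,Z) = g(∇_X Y, Z) + g(Y, ∇_X Z)`. Here `nabla Y x (X x)` is `∇_X Y` at `x`. -/
structure IsLeviCivita
    (g : Π x : M, TangentSpace I x → TangentSpace I x → ℝ)
    (nabla : CovariantDerivative I E (fun x : M ↦ TangentSpace I x)) : Prop where
  torsion_eq_zero :
    haveI : CompleteSpace E := FiniteDimensional.complete ℝ E
    nabla.torsion = 0
  metric : ∀ X Y Z : Π x : M, TangentSpace I x,
    IsSmoothField I X → IsSmoothField I Y → IsSmoothField I Z → ∀ x : M,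
      mvfderiv I (fun y ↦ g y (Y y) (Z y)) x (X x)
        = g x (nabla Y x (X x)) (Z x) + g x (Y x) (nabla Z x (X x))

/-- The `1`-form `η` is parallel: `(∇_X η)(Y) = X (η Y) - η (∇_X Y)` vanishes. -/
def IsParallelForm
    (nabla : CovariantDerivative I E (fun x : M ↦ TangentSpace I x))
    (η : Π x : M, TangentSpace I x →L[ℝ] ℝ) : Prop :=
  ∀ X Y : Π x : M, TangentSpace I x, IsSmoothField I X → IsSmoothField I Y → ∀ x : M,
    mvfderiv I (fun y ↦ η y (Y y)) x (X x) - η x (nabla Y x (X x)) = 0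

/-- `(M, J, g)` is a Vaisman manifold: it is l.c.K. and its Lee form is parallel for the
Levi-Civita connection of `g`. -/
def IsVaisman (n : ℕ)
    (J : Π x : M, TangentSpace I x → TangentSpace I x)
    (g : Π x : M, TangentSpace I x → TangentSpace I x → ℝ) : Prop :=
  IsLCK I n J g ∧ ∃ η : Π x : M, TangentSpace I x →L[ℝ] ℝ, IsLeeForm I J g η ∧
    ∃ nabla : CovariantDerivative I E (fun x : M ↦ TangentSpace I x),
      IsLeviCivita I g nabla ∧ IsParallelForm I nabla η

end General

end LCK

namespace HopfMetric

open LCK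

/-! ## The complex structures `J_{α,β}` and the metrics `g^h_{α,β}` on `S¹ × S³`

Everywhere `a` and `b` stand for the chosen logarithms of `α` and `β`. -/

/-- `ℝ⁴ = ℂ²`, with `ξ₁ = x₀ + i x₁` and `ξ₂ = x₂ + i x₃`. -/
abbrev R4 : Type := EuclideanSpace ℝ (Fin 4)

/-- The unit sphere of `ℂ²`. -/
abbrev S3 : Type := Metric.sphere (0 : R4) 1

/-- The manifold `S¹ × S³`. -/
abbrev S1S3 : Type := Circle × S3

/-- The (boundaryless) model of `S¹ × S³`. -/
abbrev mdl : ModelWithCorners ℝ (EuclideanSpace ℝ (Fin 1) × EuclideanSpace ℝ (Fin 3))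
    (ModelProd (EuclideanSpace ℝ (Fin 1)) (EuclideanSpace ℝ (Fin 3))) := (𝓡 1).prod (𝓡 3)

/-- `iQ = (iξ₁, iξ₂)`. -/
def quatI (x : R4) : R4 := !₂[-x 1, x 0, -x 3, x 2]

/-- `jQ = (-ξ̄₂, ξ̄₁)`. -/
def quatJ (x : R4) : R4 := !₂[-x 2, x 3, x 0, -x 1]

/-- `kQ = (-iξ̄₂, iξ̄₁)`. -/
def quatK (x : R4) : R4 := !₂[-x 3, -x 2, x 1, x 0]

/-- The great circle `t ↦ cos t • Q + sin t • u Q`, where `u Q` is a unit vector orthogonal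
to `Q`. -/
def greatCircle (u : R4 → R4) (hu : ∀ x : R4, ‖u x‖ = ‖x‖ ∧ inner ℝ x (u x) = 0) (Q : S3)
    (t : ℝ) : S3 :=
  ⟨Real.cos t • (Q : R4) + Real.sin t • u Q, by
    have hQ : ‖(Q : R4)‖ = 1 := norm_eq_of_mem_sphere Q
    have h1 : ‖u (Q : R4)‖ = 1 := (hu Q).1.trans hQ
    have h2 : inner ℝ (Q : R4) (u Q) = 0 := (hu Q).2
    rw [mem_sphere_zero_iff_norm]
    have : ‖Real.cos t • (Q : R4) + Real.sin t • u Q‖ ^ 2 = 1 := by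
      rw [norm_add_sq_real, norm_smul, norm_smul, inner_smul_left, inner_smul_right, h2, hQ, h1]
      simp
    nlinarith [norm_nonneg (Real.cos t • (Q : R4) + Real.sin t • u Q)]⟩

lemma quatI_spec (x : R4) : ‖quatI x‖ = ‖x‖ ∧ inner ℝ x (quatI x) = 0 := by
  constructor
  · simp only [EuclideanSpace.norm_eq, quatI, Fin.sum_univ_four, Real.norm_eq_abs, sq_abs]
    congr 1; simp; ring
  · simp [quatI, PiLp.inner_apply, Fin.sum_univ_four]; ring

lemma quatJ_spec (x : R4) : ‖quatJ x‖ = ‖x‖ ∧ inner ℝ x (quatJ x) = 0 := by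
  constructor
  · simp only [EuclideanSpace.norm_eq, quatJ, Fin.sum_univ_four, Real.norm_eq_abs, sq_abs]
    congr 1; simp; ring
  · simp [quatJ, PiLp.inner_apply, Fin.sum_univ_four]; ring

lemma quatK_spec (x : R4) : ‖quatK x‖ = ‖x‖ ∧ inner ℝ x (quatK x) = 0 := by
  constructor
  · simp only [EuclideanSpace.norm_eq, quatK, Fin.sum_univ_four, Real.norm_eq_abs, sq_abs]
    congr 1; simp; ring
  · simp [quatK, PiLp.inner_apply, Fin.sum_univ_four]; ring

/-- The curves through `p = (θ, Q)` whose velocities are the frame `e₁, e₂, e₃, e₄`: the rotation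
of `S¹`, and the great circles of `S³` through `Q` in the directions `iQ`, `jQ`, `kQ`. -/
def frameCurve (p : S1S3) : Fin 4 → ℝ → S1S3 :=
  ![fun t ↦ (Circle.exp t * p.1, p.2),
    fun t ↦ (p.1, greatCircle quatI quatI_spec p.2 t),
    fun t ↦ (p.1, greatCircle quatJ quatJ_spec p.2 t),
    fun t ↦ (p.1, greatCircle quatK quatK_spec p.2 t)]

lemma frameCurve_zero (p : S1S3) (i : Fin 4) : frameCurve p i 0 = p := by
  fin_cases i <;> simp [frameCurve, greatCircle]

/-- The parallelization `e₁, e₂, e₃, e₄` of `S¹ × S³` (indexed by `0, 1, 2, 3`). -/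
def frame (p : S1S3) (i : Fin 4) : TangentSpace mdl p :=
  frameCurve_zero p i ▸ (mfderiv 𝓘(ℝ, ℝ) mdl (frameCurve p i) 0 (1 : ℝ) :
    TangentSpace mdl (frameCurve p i 0))

/-- The differential at `p` of the inclusion `S¹ × S³ → ℂ`, `(θ, Q) ↦ e^{iθ}`. -/
def dCircle (p : S1S3) : TangentSpace mdl p →L[ℝ] ℂ :=
  mvfderiv mdl (fun q : S1S3 ↦ (q.1 : ℂ)) p

/-- The differential at `p` of the map `S¹ × S³ → ℂ²`, `(θ, Q) ↦ Q`. -/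
def dSphere (p : S1S3) : TangentSpace mdl p →L[ℝ] R4 :=
  mvfderiv mdl (fun q : S1S3 ↦ (q.2 : R4)) p

/-- The dual coframe `e¹, e², e³, e⁴`: the components of a tangent vector in the frame. -/
def coframe (p : S1S3) (v : TangentSpace mdl p) : Fin 4 → ℝ :=
  ![inner ℝ (Complex.I * (p.1 : ℂ)) (dCircle p v),
    inner ℝ (quatI p.2) (dSphere p v),
    inner ℝ (quatJ p.2) (dSphere p v),
    inner ℝ (quatK p.2) (dSphere p v)]

/-- The coordinate `ξ₁` of the point `(θ, (ξ₁, ξ₂))`. -/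
def xi1 (p : S1S3) : ℂ := ⟨(p.2 : R4) 0, (p.2 : R4) 1⟩

/-- The coordinate `ξ₂` of the point `(θ, (ξ₁, ξ₂))`. -/
def xi2 (p : S1S3) : ℂ := ⟨(p.2 : R4) 2, (p.2 : R4) 3⟩

/-- `G = ‖ξ₁‖² log α + ‖ξ₂‖² log β`. -/
def G (a b : ℂ) (p : S1S3) : ℂ :=
  (‖xi1 p‖ ^ 2 : ℝ) * a + (‖xi2 p‖ ^ 2 : ℝ) * b

/-- The components of `J e₁, J e₂, J e₃, J e₄` in the frame (row `i` for `J eᵢ`); here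
`a - b` is `log (α / β)`. -/
def JMatrix (a b : ℂ) (p : S1S3) : Matrix (Fin 4) (Fin 4) ℝ :=
  let g := G a b p
  let c := xi1 p * xi2 p * (a - b)
  let d := Complex.I * (xi1 p * xi2 p) * (starRingEnd ℂ) g * (a - b)
  !![-(g.im / g.re), ‖g‖ ^ 2 / (2 * Real.pi * g.re),
      -(d.re / (2 * Real.pi * g.re)), -(d.im / (2 * Real.pi * g.re));
    -(2 * Real.pi / g.re), g.im / g.re, -(c.re / g.re), -(c.im / g.re);
    0, 0, 0, 1;
    0, 0, -1, 0]

/-- The complex structure `J_{α,β}` of `S¹ × S³`. -/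
def J (a b : ℂ) (p : S1S3) (v : TangentSpace mdl p) : TangentSpace mdl p :=
  ∑ i, coframe p v i • ∑ j, JMatrix a b p i j • frame p j

/-- The components `x₂, x₃` of a tangent vector in the `J_{α,β}`-complex basis `(e₂, e₃)`:
`v = x₂ e₂ + x₃ e₃`, where `(s + i t) e = s e + t J e` (see `eq_complexCoord_smul`). -/
def complexCoord (a b : ℂ) (p : S1S3) (v : TangentSpace mdl p) : Fin 2 → ℂ :=
  ![coframe p v 1 - Complex.I * G a b p / (2 * Real.pi) * coframe p v 0,
    coframe p v 2 + Complex.I * coframe p v 3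
      - xi1 p * xi2 p * (a - b) / (2 * Real.pi) * coframe p v 0]

/-- The Hermitian matrix of `g^h_{α,β}` in the complex basis `(e₂, e₃)`; the value of the
`2π`-periodic function `h` at the point `e^{iθ}` of `S¹` is `h (arg e^{iθ})`, and
`a.re - b.re` is `log (‖α‖ / ‖β‖)`. -/
def metricMatrix (a b : ℂ) (h : ℝ → ℝ) (p : S1S3) : Matrix (Fin 2) (Fin 2) ℂ :=
  let R : ℝ := (G a b p).re
  let L : ℝ := a.re - b.re
  !![((Real.pi * h (Complex.arg p.1) / R ^ 2
        + ‖xi1 p‖ ^ 2 * ‖xi2 p‖ ^ 2 * L ^ 2 / R ^ 3 : ℝ) : ℂ),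
      Complex.I * (xi1 p * xi2 p) * L / R ^ 2;
    (starRingEnd ℂ) (Complex.I * (xi1 p * xi2 p)) * L / R ^ 2,
      ((1 / R : ℝ) : ℂ)]

/-- The metric `g^h_{α,β}`: the real part of the Hermitian form (complex linear in the first
variable) whose matrix in the `J_{α,β}`-complex basis `(e₂, e₃)` is `metricMatrix`. -/
def metric (a b : ℂ) (h : ℝ → ℝ) (p : S1S3) (v w : TangentSpace mdl p) : ℝ :=
  (∑ i, ∑ j, metricMatrix a b h p i j * complexCoord a b p v i
    * (starRingEnd ℂ) (complexCoord a b p w j)).re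

/-! ### The definitions above have their intended meaning -/

lemma mvfderiv_velocity {F : Type*} [NormedAddCommGroup F] [NormedSpace ℝ F]
    {f : S1S3 → F} {γ : ℝ → S1S3} {p : S1S3} (hγ0 : γ 0 = p)
    (hf : MDifferentiableAt mdl 𝓘(ℝ, F) f p)
    (hγ : MDifferentiableAt 𝓘(ℝ, ℝ) mdl γ 0) {v : F} (hv : HasDerivAt (f ∘ γ) v 0) :
    mvfderiv mdl f p (hγ0 ▸ (mfderiv 𝓘(ℝ, ℝ) mdl γ 0 (1 : ℝ) : TangentSpace mdl (γ 0))) = v := by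
  subst hγ0
  have h := mfderiv_comp (I := 𝓘(ℝ, ℝ)) (I' := mdl) (I'' := 𝓘(ℝ, F)) (0 : ℝ) hf hγ
  have h2 := congrArg (fun L => L (1 : ℝ)) h
  have h3 : mfderiv 𝓘(ℝ, ℝ) 𝓘(ℝ, F) (f ∘ γ) 0 (1 : ℝ) = v := by
    rw [mfderiv_eq_fderiv]; rw [hv.hasFDerivAt.fderiv]; exact one_smul ℝ v
  exact (h2.symm.trans h3)

lemma mdifferentiableAt_circle (p : S1S3) :
    MDifferentiableAt mdl 𝓘(ℝ, ℂ) (fun q : S1S3 ↦ (q.1 : ℂ)) p := by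
  have := finrank_real_complex_fact'
  have h1 : ContMDiff (𝓡 1) 𝓘(ℝ, ℂ) 1 (fun z : Circle ↦ (z : ℂ)) :=
    contMDiff_coe_sphere (E := ℂ) (n := 1)
  exact (h1.comp (contMDiff_fst (I := 𝓡 1) (J := 𝓡 3))).mdifferentiableAt one_ne_zero

lemma mdifferentiableAt_sphere (p : S1S3) :
    MDifferentiableAt mdl 𝓘(ℝ, R4) (fun q : S1S3 ↦ (q.2 : R4)) p := by
  have : Fact (Module.finrank ℝ R4 = 3 + 1) := ⟨by simp⟩
  have h1 : ContMDiff (𝓡 3) 𝓘(ℝ, R4) 1 (fun z : S3 ↦ (z : R4)) :=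
    contMDiff_coe_sphere (E := R4) (n := 3)
  exact (h1.comp (contMDiff_snd (I := 𝓡 1) (J := 𝓡 3))).mdifferentiableAt one_ne_zero

lemma mdifferentiableAt_greatCircle (u : R4 → R4)
    (hu : ∀ x : R4, ‖u x‖ = ‖x‖ ∧ inner ℝ x (u x) = 0) (Q : S3) :
    MDifferentiableAt 𝓘(ℝ, ℝ) (𝓡 3) (greatCircle u hu Q) 0 := by
  have : Fact (Module.finrank ℝ R4 = 3 + 1) := ⟨by simp⟩
  have h1 : ContMDiff 𝓘(ℝ, ℝ) 𝓘(ℝ, R4) 1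
      (fun t : ℝ ↦ Real.cos t • (Q : R4) + Real.sin t • u Q) :=
    ((Real.contDiff_cos.smul contDiff_const).add
      (Real.contDiff_sin.smul contDiff_const)).contMDiff
  exact (h1.codRestrict_sphere (n := 3)
    fun t ↦ (greatCircle u hu Q t).2).mdifferentiableAt one_ne_zero

lemma mdifferentiableAt_frameCurve (p : S1S3) (i : Fin 4) :
    MDifferentiableAt 𝓘(ℝ, ℝ) mdl (frameCurve p i) 0 := by
  have hc : MDifferentiableAt 𝓘(ℝ, ℝ) (𝓡 1) (fun t : ℝ ↦ Circle.exp t * p.1) 0 := by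
    have h1 : ContMDiff 𝓘(ℝ, ℝ) (𝓡 1) ω (fun t : ℝ ↦ Circle.exp t * p.1) :=
      contMDiff_circleExp.mul contMDiff_const
    exact (h1.of_le le_top).mdifferentiableAt one_ne_zero
  fin_cases i
  · exact hc.prodMk mdifferentiableAt_const
  · exact mdifferentiableAt_const.prodMk (mdifferentiableAt_greatCircle quatI quatI_spec p.2)
  · exact mdifferentiableAt_const.prodMk (mdifferentiableAt_greatCircle quatJ quatJ_spec p.2)
  · exact mdifferentiableAt_const.prodMk (mdifferentiableAt_greatCircle quatK quatK_spec p.2)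

lemma hasDerivAt_greatCircle (u : R4 → R4)
    (hu : ∀ x : R4, ‖u x‖ = ‖x‖ ∧ inner ℝ x (u x) = 0) (Q : S3) :
    HasDerivAt (fun t : ℝ ↦ (greatCircle u hu Q t : R4)) (u Q) 0 := by
  have := ((Real.hasDerivAt_cos 0).smul_const (Q : R4)).add
    ((Real.hasDerivAt_sin 0).smul_const (u (Q : R4)))
  simpa using! this

/-- `e₁` is `i e^{iθ}` in `T S¹`, and `e₂, e₃, e₄` have no component in `T S¹`. -/
lemma dCircle_frame (p : S1S3) (i : Fin 4) :
    dCircle p (frame p i) = (![Complex.I * (p.1 : ℂ), 0, 0, 0] : Fin 4 → ℂ) i := by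
  refine mvfderiv_velocity (frameCurve_zero p i) (mdifferentiableAt_circle p)
    (mdifferentiableAt_frameCurve p i) ?_
  fin_cases i
  · have h1 : HasDerivAt (fun t : ℝ ↦ Complex.exp (t * Complex.I) * (p.1 : ℂ))
        (Complex.I * (p.1 : ℂ)) 0 := by
      have h2 : HasDerivAt (fun t : ℝ ↦ (t : ℂ) * Complex.I) Complex.I 0 := by
        simpa using! (Complex.ofRealCLM.hasDerivAt (x := (0 : ℝ))).mul_const Complex.I
      simpa using! (h2.cexp.mul_const (p.1 : ℂ))
    simpa [frameCurve, Function.comp_def, Circle.coe_exp] using! h1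
  all_goals exact hasDerivAt_const (0 : ℝ) (p.1 : ℂ)

/-- `e₂, e₃, e₄` are `iQ, jQ, kQ` in `T S³`, and `e₁` has no component in `T S³`. -/
lemma dSphere_frame (p : S1S3) (i : Fin 4) :
    dSphere p (frame p i) = (![0, quatI p.2, quatJ p.2, quatK p.2] : Fin 4 → R4) i := by
  refine mvfderiv_velocity (frameCurve_zero p i) (mdifferentiableAt_sphere p)
    (mdifferentiableAt_frameCurve p i) ?_
  fin_cases i
  · exact hasDerivAt_const (0 : ℝ) (p.2 : R4)
  · exact hasDerivAt_greatCircle quatI quatI_spec p.2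
  · exact hasDerivAt_greatCircle quatJ quatJ_spec p.2
  · exact hasDerivAt_greatCircle quatK quatK_spec p.2

lemma S3_sq_sum (Q : S3) :
    (Q : R4) 0 ^ 2 + (Q : R4) 1 ^ 2 + (Q : R4) 2 ^ 2 + (Q : R4) 3 ^ 2 = 1 := by
  have hQ : ‖(Q : R4)‖ = 1 := norm_eq_of_mem_sphere Q
  have := EuclideanSpace.norm_sq_eq (Q : R4)
  simp [hQ, Fin.sum_univ_four] at this
  linarith

/-- `coframe` is dual to `frame`. -/
lemma coframe_frame (p : S1S3) (i j : Fin 4) :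
    coframe p (frame p i) j = if i = j then 1 else 0 := by
  have hQ := S3_sq_sum p.2
  have hz : inner ℝ (Complex.I * (p.1 : ℂ)) (Complex.I * (p.1 : ℂ)) = 1 := by
    rw [real_inner_self_eq_norm_sq]; simp [Circle.norm_coe]
  fin_cases i <;> fin_cases j <;>
    simp [coframe, dCircle_frame, dSphere_frame, hz, -Complex.inner, quatI, quatJ, quatK,
      PiLp.inner_apply, Fin.sum_univ_four, -inner_self_eq_norm_sq_to_K] <;> nlinarith

lemma coframe_sum_smul (p : S1S3) (c : Fin 4 → ℝ) (j : Fin 4) :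
    coframe p (∑ i, c i • frame p i) j = c j := by
  have h : ∀ v w : TangentSpace mdl p, ∀ r : ℝ,
      coframe p (r • v + w) j = r * coframe p v j + coframe p w j := by
    intro v w r
    fin_cases j <;> simp only [coframe, map_add, map_smul, inner_add_right, inner_smul_right] <;> rfl
  have h0 : coframe p 0 j = 0 := by
    fin_cases j <;> simp only [coframe, map_zero, inner_zero_right] <;> rfl
  have h1 : ∀ s : Finset (Fin 4), coframe p (∑ i ∈ s, c i • frame p i) j
      = ∑ i ∈ s, c i * coframe p (frame p i) j := by
    intro s
    induction s using Finset.induction_on with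
    | empty => simpa using h0
    | insert a s ha ih => rw [Finset.sum_insert ha, Finset.sum_insert ha, h, ih]
  rw [h1]
  simp [coframe_frame]

/-- `e₁, e₂, e₃, e₄` is a basis of the tangent space, with components `coframe`. -/
lemma sum_coframe_smul_frame (p : S1S3) (v : TangentSpace mdl p) :
    ∑ i, coframe p v i • frame p i = v := by
  have hli : LinearIndependent ℝ (frame p) := by
    rw [Fintype.linearIndependent_iff]
    intro c hc i
    rw [← coframe_sum_smul p c i, hc]
    have := coframe_sum_smul p 0 i
    simpa using this
  have hfr : Module.finrank ℝ (TangentSpace mdl p) = 4 := by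
    change Module.finrank ℝ (EuclideanSpace ℝ (Fin 1) × EuclideanSpace ℝ (Fin 3)) = 4
    simp
  have : FiniteDimensional ℝ (TangentSpace mdl p) := Module.finite_of_finrank_eq_succ hfr
  have hspan := hli.span_eq_top_of_card_eq_finrank' (by rw [hfr]; simp)
  have hv : v ∈ Submodule.span ℝ (Set.range (frame p)) := hspan ▸ Submodule.mem_top
  obtain ⟨c, rfl⟩ := (Submodule.mem_span_range_iff_exists_fun ℝ).1 hv
  simp [coframe_sum_smul]

lemma J_frame (a b : ℂ) (p : S1S3) (i : Fin 4) :
    J a b p (frame p i) = ∑ j, JMatrix a b p i j • frame p j := by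
  simp [J, coframe_frame]

lemma ext_coframe {p : S1S3} {v w : TangentSpace mdl p}
    (h : ∀ i, coframe p v i = coframe p w i) : v = w := by
  rw [← sum_coframe_smul_frame p v, ← sum_coframe_smul_frame p w]
  simp [h]

/-- `v = x₂ e₂ + x₃ e₃` in the complex vector space `(T_p (S¹ × S³), J_{α,β})`. -/
lemma eq_complexCoord_smul (a b : ℂ) (p : S1S3) (hG : (G a b p).re ≠ 0)
    (v : TangentSpace mdl p) :
    v = (complexCoord a b p v 0).re • frame p 1
      + (complexCoord a b p v 0).im • J a b p (frame p 1)
      + (complexCoord a b p v 1).re • frame p 2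
      + (complexCoord a b p v 1).im • J a b p (frame p 2) := by
  have hπ := Real.pi_ne_zero
  simp only [J_frame]
  set c : Fin 4 → ℝ := fun j ↦ (complexCoord a b p v 0).re * (if j = 1 then 1 else 0)
      + (complexCoord a b p v 0).im * JMatrix a b p 1 j
      + (complexCoord a b p v 1).re * (if j = 2 then 1 else 0)
      + (complexCoord a b p v 1).im * JMatrix a b p 2 j with hc
  have hsum : (complexCoord a b p v 0).re • frame p 1
      + (complexCoord a b p v 0).im • ∑ j, JMatrix a b p 1 j • frame p j
      + (complexCoord a b p v 1).re • frame p 2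
      + (complexCoord a b p v 1).im • ∑ j, JMatrix a b p 2 j • frame p j
      = ∑ j, c j • frame p j := by
    simp only [Fin.sum_univ_four, hc]
    simp
    module
  rw [hsum]
  refine ext_coframe fun j ↦ ?_
  rw [coframe_sum_smul]
  have e1 : (2 * (Real.pi : ℂ)) = ((2 * Real.pi : ℝ) : ℂ) := by push_cast; rfl
  fin_cases j <;>
    simp [hc, complexCoord, JMatrix, e1, Complex.div_re, Complex.div_im, -Complex.ofReal_mul, Complex.normSq] <;> field_simp <;> ring

/-- The differential of `(θ, ξ) ↦ (e^{θ log α / 2π} ξ₁, e^{θ log β / 2π} ξ₂)`, the covering map of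
the identification of `S¹ × S³` with `(ℂ² ∖ 0) / ⟨(z₁, z₂) ↦ (α z₁, β z₂)⟩`. -/
def dF (a b : ℂ) (θ : ℝ) (p : S1S3) (v : TangentSpace mdl p) : Fin 2 → ℂ :=
  let e1 : ℂ := Complex.exp (θ * a / (2 * Real.pi))
  let e2 : ℂ := Complex.exp (θ * b / (2 * Real.pi))
  ![a / (2 * Real.pi) * e1 * xi1 p * coframe p v 0 + e1 * ⟨dSphere p v 0, dSphere p v 1⟩,
    b / (2 * Real.pi) * e2 * xi2 p * coframe p v 0 + e2 * ⟨dSphere p v 2, dSphere p v 3⟩]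

lemma dF_sum_smul (a b : ℂ) (θ : ℝ) (p : S1S3) (c : Fin 4 → ℝ) :
    dF a b θ p (∑ i, c i • frame p i) =
      ![Complex.exp (θ * a / (2 * Real.pi)) * (a / (2 * Real.pi) * xi1 p * c 0
          + Complex.I * xi1 p * c 1 - (starRingEnd ℂ) (xi2 p) * (c 2 + c 3 * Complex.I)),
        Complex.exp (θ * b / (2 * Real.pi)) * (b / (2 * Real.pi) * xi2 p * c 0
          + Complex.I * xi2 p * c 1 + (starRingEnd ℂ) (xi1 p) * (c 2 + c 3 * Complex.I))] := by
  have h : dSphere p (∑ i, c i • frame p i)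
      = c 1 • quatI p.2 + c 2 • quatJ p.2 + c 3 • quatK p.2 := by
    rw [Fin.sum_univ_four, map_add, map_add, map_add, map_smul, map_smul, map_smul, map_smul,
      dSphere_frame, dSphere_frame, dSphere_frame, dSphere_frame]
    simp
  have h1 : (⟨dSphere p (∑ i, c i • frame p i) 0, dSphere p (∑ i, c i • frame p i) 1⟩ : ℂ)
      = Complex.I * xi1 p * c 1 - (starRingEnd ℂ) (xi2 p) * (c 2 + c 3 * Complex.I) := by
    rw [h]
    apply Complex.ext <;> simp [quatI, quatJ, quatK, xi1, xi2] <;> ring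
  have h2 : (⟨dSphere p (∑ i, c i • frame p i) 2, dSphere p (∑ i, c i • frame p i) 3⟩ : ℂ)
      = Complex.I * xi2 p * c 1 + (starRingEnd ℂ) (xi1 p) * (c 2 + c 3 * Complex.I) := by
    rw [h]
    apply Complex.ext <;> simp [quatI, quatJ, quatK, xi1, xi2] <;> ring
  simp only [dF, h1, h2, coframe_sum_smul]
  congr 1
  · ring
  · congr 1
    ring

/-- `J_{α,β}` is the complex structure transferred from `ℂ² ∖ 0`. -/
lemma dF_J (a b : ℂ) (θ : ℝ) (p : S1S3) (hG : (G a b p).re ≠ 0) (v : TangentSpace mdl p) :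
    dF a b θ p (J a b p v) = Complex.I • dF a b θ p v := by
  have hπ : (Real.pi : ℂ) ≠ 0 := by exact_mod_cast Real.pi_ne_zero
  have hR : ((G a b p).re : ℂ) ≠ 0 := by exact_mod_cast hG
  have hJ : J a b p v = ∑ j, (∑ i, coframe p v i * JMatrix a b p i j) • frame p j := by
    simp only [J, Fin.sum_univ_four]
    module
  have hN : (starRingEnd ℂ) (xi1 p) * xi1 p + (starRingEnd ℂ) (xi2 p) * xi2 p = 1 := by
    have hQ := S3_sq_sum p.2
    apply Complex.ext <;> simp [xi1, xi2]
    · nlinarith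
    · ring
  have hg : G a b p = (starRingEnd ℂ) (xi1 p) * xi1 p * a + (starRingEnd ℂ) (xi2 p) * xi2 p * b := by
    simp only [G, Complex.conj_mul']
    push_cast
    ring
  have hn : ((‖G a b p‖ : ℂ)) ^ 2 = (starRingEnd ℂ) (G a b p) * G a b p := by
    rw [Complex.conj_mul']
  have hre : (starRingEnd ℂ) (G a b p) = (G a b p).re - (G a b p).im * Complex.I := by
    apply Complex.ext <;> simp
  have hgg : G a b p = (G a b p).re + (G a b p).im * Complex.I := by
    apply Complex.ext <;> simp
  conv_rhs => rw [← sum_coframe_smul_frame p v]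
  rw [hJ, dF_sum_smul, dF_sum_smul]
  simp only [JMatrix, Fin.sum_univ_four]
  set g := G a b p with hgdef
  set c := xi1 p * xi2 p * (a - b) with hc
  set d := Complex.I * (xi1 p * xi2 p) * (starRingEnd ℂ) g * (a - b) with hd
  have hcc : (c.re : ℂ) = c - c.im * Complex.I := by
    linear_combination Complex.re_add_im c
  have hdd : (d.re : ℂ) = d - d.im * Complex.I := by
    linear_combination Complex.re_add_im d
  have hI := Complex.I_sq
  have h11 : a / (2 * Real.pi) * xi1 p * (-(g.im / g.re))
      + Complex.I * xi1 p * ((‖g‖ : ℂ) ^ 2 / (2 * Real.pi * g.re))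
      - (starRingEnd ℂ) (xi2 p) * (-(d.re / (2 * Real.pi * g.re))
        + -(d.im / (2 * Real.pi * g.re)) * Complex.I)
      = Complex.I * (a / (2 * Real.pi) * xi1 p) := by
    rw [hn, hdd, hd]
    field_simp
    linear_combination xi1 p * Complex.I * (starRingEnd ℂ) g * hg
      + xi1 p * Complex.I * (starRingEnd ℂ) g * a * hN
      + xi1 p * Complex.I * a * hre - xi1 p * a * g.im * hI
  have h12 : a / (2 * Real.pi) * xi1 p * (-(2 * Real.pi / g.re))
      + Complex.I * xi1 p * (g.im / g.re)
      - (starRingEnd ℂ) (xi2 p) * (-(c.re / g.re) + -(c.im / g.re) * Complex.I)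
      = Complex.I * (Complex.I * xi1 p) := by
    rw [hcc, hc]
    field_simp
    linear_combination xi1 p * hg + xi1 p * a * hN - xi1 p * hgg - xi1 p * g.re * hI
  have h21 : b / (2 * Real.pi) * xi2 p * (-(g.im / g.re))
      + Complex.I * xi2 p * ((‖g‖ : ℂ) ^ 2 / (2 * Real.pi * g.re))
      + (starRingEnd ℂ) (xi1 p) * (-(d.re / (2 * Real.pi * g.re))
        + -(d.im / (2 * Real.pi * g.re)) * Complex.I)
      = Complex.I * (b / (2 * Real.pi) * xi2 p) := by
    rw [hn, hdd, hd]
    field_simp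
    linear_combination xi2 p * Complex.I * (starRingEnd ℂ) g * hg
      + xi2 p * Complex.I * (starRingEnd ℂ) g * b * hN
      + xi2 p * Complex.I * b * hre - xi2 p * b * g.im * hI
  have h22 : b / (2 * Real.pi) * xi2 p * (-(2 * Real.pi / g.re))
      + Complex.I * xi2 p * (g.im / g.re)
      + (starRingEnd ℂ) (xi1 p) * (-(c.re / g.re) + -(c.im / g.re) * Complex.I)
      = Complex.I * (Complex.I * xi2 p) := by
    rw [hcc, hc]
    field_simp
    linear_combination xi2 p * hg + xi2 p * b * hN - xi2 p * hgg - xi2 p * g.re * hI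
  ext k
  fin_cases k
  · simp
    linear_combination Complex.exp (θ * a / (2 * Real.pi)) * (coframe p v 0 * h11
      + coframe p v 1 * h12 + (starRingEnd ℂ) (xi2 p) * coframe p v 3 * hI)
  · simp
    linear_combination Complex.exp (θ * b / (2 * Real.pi)) * (coframe p v 0 * h21
      + coframe p v 1 * h22 - (starRingEnd ℂ) (xi1 p) * coframe p v 3 * hI)

end HopfMetric

end

namespace LCK

section Calculus

open Bundle VectorField Set FiberBundle

variable {E : Type*} [NormedAddCommGroup E] [NormedSpace ℝ E]
  {H : Type*} [TopologicalSpace H] {I : ModelWithCorners ℝ E H}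
  {M : Type*} [TopologicalSpace M] [ChartedSpace H M]
  {F : Type*} [NormedAddCommGroup F] [NormedSpace ℝ F]

/-- The differential of a smooth function, applied to a smooth field, is smooth. -/
lemma contMDiffAt_mvfderiv_apply [IsManifold I ∞ M] {f : M → F} {X : Π x : M, TangentSpace I x}
    {x : M}
    (hf : ContMDiffAt I 𝓘(ℝ, F) ∞ f x)
    (hX : ContMDiffAt I I.tangent ∞ (fun x ↦ (⟨x, X x⟩ : TangentBundle I M)) x) :
    ContMDiffAt I 𝓘(ℝ, F) ∞ (fun y ↦ mvfderiv I f y (X y)) x := by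
  have h1 : ContMDiffAt I 𝓘(ℝ, E →L[ℝ] F) ∞
      (inTangentCoordinates I 𝓘(ℝ, F) id f (mfderiv I 𝓘(ℝ, F) f) x) x :=
    hf.mfderiv_const (m := ∞) (by simp)
  have h2 := ContMDiffAt.clm_apply_of_inCoordinates (IM := I) (b₁ := id) (b₂ := f)
    (E₁ := fun x : M ↦ TangentSpace I x) (E₂ := fun x : F ↦ TangentSpace 𝓘(ℝ, F) x)
    (v := X) (ϕ := mfderiv I 𝓘(ℝ, F) f) h1 hX hf
  have h3 := (contMDiff_snd_tangentBundle_modelSpace F 𝓘(ℝ, F) (n := ∞)).contMDiffAt.comp x h2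
  exact h3

lemma mdifferentiableAt_mvfderiv_apply [IsManifold I 2 M] {f : M → F}
    {X : Π x : M, TangentSpace I x} {x : M}
    (hf : ContMDiffAt I 𝓘(ℝ, F) 2 f x)
    (hX : MDifferentiableAt I I.tangent (fun x ↦ (⟨x, X x⟩ : TangentBundle I M)) x) :
    MDifferentiableAt I 𝓘(ℝ, F) (fun y ↦ mvfderiv I f y (X y)) x := by
  have h1 : ContMDiffAt I 𝓘(ℝ, E →L[ℝ] F) 1
      (inTangentCoordinates I 𝓘(ℝ, F) id f (mfderiv I 𝓘(ℝ, F) f) x) x :=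
    hf.mfderiv_const (m := 1) (by norm_num)
  have h2 := MDifferentiableAt.clm_apply_of_inCoordinates (IM := I) (b₁ := id) (b₂ := f)
    (E₁ := fun x : M ↦ TangentSpace I x) (E₂ := fun x : F ↦ TangentSpace 𝓘(ℝ, F) x)
    (v := X) (ϕ := mfderiv I 𝓘(ℝ, F) f)
    (h1.mdifferentiableAt one_ne_zero) hX
    (hf.mdifferentiableAt two_ne_zero)
  have h3 := ((contMDiff_snd_tangentBundle_modelSpace F 𝓘(ℝ, F)
    (n := 1)).mdifferentiable one_ne_zero _).comp x h2
  exact h3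

/-- The differential of a function, computed in a chart. -/
lemma mvfderiv_eq_fderivWithin [IsManifold I 1 M] {f : M → F} {x : M} {y : E}
    (hy : y ∈ (extChartAt I x).target)
    (hf : MDifferentiableAt I 𝓘(ℝ, F) f ((extChartAt I x).symm y))
    (v : TangentSpace I ((extChartAt I x).symm y)) :
    mvfderiv I f ((extChartAt I x).symm y) v
      = fderivWithin ℝ (f ∘ (extChartAt I x).symm) (range I) y
        ((mfderivWithin 𝓘(ℝ, E) I (extChartAt I x).symm (range I) y).inverse v) := by
  have hinv := isInvertible_mfderivWithin_extChartAt_symm (I := I) hy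
  have hψ := mdifferentiableWithinAt_extChartAt_symm (I := I) hy
  have huniq : UniqueMDiffWithinAt 𝓘(ℝ, E) (range I) y :=
    (I.uniqueDiffOn _ (extChartAt_target_subset_range x hy)).uniqueMDiffWithinAt
  have hc := mfderiv_comp_mfderivWithin (I := 𝓘(ℝ, E)) (I' := I) (I'' := 𝓘(ℝ, F)) y hf hψ huniq
  obtain ⟨e, he⟩ := hinv
  have hf' : fderivWithin ℝ (f ∘ (extChartAt I x).symm) (range I) y
      = (mfderiv I 𝓘(ℝ, F) f ((extChartAt I x).symm y)).comp
        (mfderivWithin 𝓘(ℝ, E) I (extChartAt I x).symm (range I) y) :=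
    (mfderivWithin_eq_fderivWithin ..).symm.trans hc
  have hv : mfderivWithin 𝓘(ℝ, E) I (extChartAt I x).symm (range I) y
      ((mfderivWithin 𝓘(ℝ, E) I (extChartAt I x).symm (range I) y).inverse v) = v := by
    rw [← he, ContinuousLinearMap.inverse_equiv]
    exact e.apply_symm_apply v
  have h1 := congrArg (fun K ↦ K
    ((mfderivWithin 𝓘(ℝ, E) I (extChartAt I x).symm (range I) y).inverse v)) hf'
  refine (h1.trans ?_).symm
  exact congrArg (mfderiv I 𝓘(ℝ, F) f ((extChartAt I x).symm y)) hv

/-- `[X, Y] f = X (Y f) - Y (X f)`. -/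
lemma mvfderiv_mlieBracket [IsManifold I ∞ M] [CompleteSpace E] [BoundarylessManifold I M]
    [I.Boundaryless]
    {f : M → F} {X Y : Π x : M, TangentSpace I x} {x : M}
    (hf : ContMDiff I 𝓘(ℝ, F) ∞ f)
    (hX : MDifferentiableAt I I.tangent (fun x ↦ (⟨x, X x⟩ : TangentBundle I M)) x)
    (hY : MDifferentiableAt I I.tangent (fun x ↦ (⟨x, Y x⟩ : TangentBundle I M)) x) :
    mvfderiv I f x (mlieBracket I X Y x)
      = mvfderiv I (fun y ↦ mvfderiv I f y (Y y)) x (X x)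
        - mvfderiv I (fun y ↦ mvfderiv I f y (X y)) x (Y x) := by
  have h2 : (2 : WithTop ℕ∞) ≤ ∞ := ENat.LEInfty.out
  set ψ := (extChartAt I x).symm with hψ
  set y₀ := extChartAt I x x with hy₀
  have hψy : ψ y₀ = x := extChartAt_to_inv x
  set g := f ∘ ψ with hg
  have hr : range I = univ := I.range_eq_univ
  have hgs : ContDiffAt ℝ ∞ g y₀ := by
    have h1 : ContMDiffAt 𝓘(ℝ, E) 𝓘(ℝ, F) ∞ g y₀ := by
      refine (hf _).comp y₀ ?_
      have := contMDiffWithinAt_extChartAt_symm_range (I := I) (n := ∞) x (mem_extChartAt_target x)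
      rwa [hr, contMDiffWithinAt_univ] at this
    exact h1.contDiffAt
  obtain ⟨P, hP⟩ : ∃ P : (Π x : M, TangentSpace I x) → E → E,
      P = fun Z ↦ mpullbackWithin 𝓘(ℝ, E) I ψ Z (range I) := ⟨_, rfl⟩
  have key : ∀ (Z : Π x : M, TangentSpace I x) (h : M → F) (y : E), y ∈ (extChartAt I x).target →
      MDifferentiableAt I 𝓘(ℝ, F) h (ψ y) →
      mvfderiv I h (ψ y) (Z (ψ y)) = fderiv ℝ (h ∘ ψ) y (P Z y) := by
    intro Z h y hy hh
    rw [mvfderiv_eq_fderivWithin hy hh, hP, hr, fderivWithin_univ]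
    rfl
  have hV : ∀ Z : Π x : M, TangentSpace I x,
      MDifferentiableAt I I.tangent (fun x ↦ (⟨x, Z x⟩ : TangentBundle I M)) x →
      DifferentiableAt ℝ (P Z) y₀ := by
    intro Z hZ
    have h3 : DifferentiableWithinAt ℝ (P Z) (ψ ⁻¹' univ ∩ range I) y₀ := by
      rw [hP]
      exact (mdifferentiableWithinAt_univ.2 hZ).differentiableWithinAt_mpullbackWithin_vectorField
    rwa [hr, preimage_univ, inter_univ, differentiableWithinAt_univ] at h3
  have hsnd : ∀ Z W : Π x : M, TangentSpace I x,
      MDifferentiableAt I I.tangent (fun x ↦ (⟨x, Z x⟩ : TangentBundle I M)) x →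
      mvfderiv I (fun y ↦ mvfderiv I f y (Z y)) x (W x) =
        fderiv ℝ (fun y ↦ fderiv ℝ g y (P Z y)) y₀ (P W y₀) := by
    intro Z W hZ
    have h1 := key W (fun y ↦ mvfderiv I f y (Z y)) y₀ (mem_extChartAt_target x)
      (by rw [hψy]; exact mdifferentiableAt_mvfderiv_apply ((hf x).of_le h2) hZ)
    rw [hψy] at h1
    rw [h1]
    congr 1
    refine Filter.EventuallyEq.fderiv_eq ?_
    filter_upwards [extChartAt_target_mem_nhds (I := I) x] with y hy
    exact key Z f y hy (hf.mdifferentiable (by simp) _)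
  have hD : DifferentiableAt ℝ (fderiv ℝ g) y₀ :=
    (hgs.fderiv_right (m := 1) (by rw [one_add_one_eq_two]; exact h2)).differentiableAt one_ne_zero
  have hlie : mvfderiv I f x (mlieBracket I X Y x)
      = fderiv ℝ g y₀ (lieBracket ℝ (P X) (P Y) y₀) := by
    have h1 : f =ᶠ[nhds x] g ∘ extChartAt I x := by
      filter_upwards [extChartAt_source_mem_nhds (I := I) x] with z hz
      change f z = f ((extChartAt I x).symm (extChartAt I x z))
      rw [(extChartAt I x).left_inv hz]
    have h3 : mfderiv I 𝓘(ℝ, F) f x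
        = (mfderiv 𝓘(ℝ, E) 𝓘(ℝ, F) g y₀).comp (mfderiv I 𝓘(ℝ, E) (extChartAt I x) x) := by
      rw [h1.mfderiv_eq]
      exact mfderiv_comp x (hgs.differentiableAt (by simp)).mdifferentiableAt
        (mdifferentiableAt_extChartAt (mem_chart_source H x))
    obtain ⟨e, he⟩ := isInvertible_mfderiv_extChartAt (I := I) (mem_extChartAt_source (I := I) x)
    obtain ⟨w, hw⟩ : ∃ w : E, w = lieBracketWithin ℝ (P X) (P Y) (ψ ⁻¹' univ ∩ range I) y₀ :=
      ⟨_, rfl⟩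
    have h4 : mlieBracket I X Y x = e.symm w := by
      rw [← mlieBracketWithin_univ, mlieBracketWithin_apply, ← he,
        ContinuousLinearMap.inverse_equiv, hw, hP]
      rfl
    rw [← he] at h3
    rw [hr, preimage_univ, inter_univ, lieBracketWithin_univ] at hw
    rw [h4]
    change mfderiv I 𝓘(ℝ, F) f x _ = _
    rw [h3, mfderiv_eq_fderiv, ← hw]
    exact congrArg (fderiv ℝ g y₀) (e.apply_symm_apply w)
  rw [hsnd Y X hY, hsnd X Y hX, hlie, fderiv_clm_apply hD (hV Y hY), fderiv_clm_apply hD (hV X hX)]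
  have hsymm : IsSymmSndFDerivAt ℝ g y₀ := hgs.isSymmSndFDerivAt (by simpa using h2)
  have := hsymm (P X y₀) (P Y y₀)
  simp only [lieBracket, map_sub, add_apply, ContinuousLinearMap.comp_apply,
    ContinuousLinearMap.flip_apply, this]
  abel

end Calculus
section TwoForms

variable {E : Type*} [NormedAddCommGroup E] [NormedSpace ℝ E]
  {H : Type*} [TopologicalSpace H] {I : ModelWithCorners ℝ E H}
  {M : Type*} [TopologicalSpace M] [ChartedSpace H M]

lemma extDerivTwo_add
    {Ω Ψ : Π x : M, TangentSpace I x → TangentSpace I x → ℝ}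
    {X Y Z : Π x : M, TangentSpace I x} {x : M}
    (h1 : MDifferentiableAt I 𝓘(ℝ, ℝ) (fun y ↦ Ω y (X y) (Y y)) x)
    (h2 : MDifferentiableAt I 𝓘(ℝ, ℝ) (fun y ↦ Ω y (Y y) (Z y)) x)
    (h3 : MDifferentiableAt I 𝓘(ℝ, ℝ) (fun y ↦ Ω y (Z y) (X y)) x)
    (k1 : MDifferentiableAt I 𝓘(ℝ, ℝ) (fun y ↦ Ψ y (X y) (Y y)) x)
    (k2 : MDifferentiableAt I 𝓘(ℝ, ℝ) (fun y ↦ Ψ y (Y y) (Z y)) x)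
    (k3 : MDifferentiableAt I 𝓘(ℝ, ℝ) (fun y ↦ Ψ y (Z y) (X y)) x) :
    extDerivTwo I (fun x v w ↦ Ω x v w + Ψ x v w) X Y Z x
      = extDerivTwo I Ω X Y Z x + extDerivTwo I Ψ X Y Z x := by
  simp only [extDerivTwo, mvfderiv_fun_add h1 k1, mvfderiv_fun_add h2 k2, mvfderiv_fun_add h3 k3,
    add_apply]
  ring

/-- `d (φ Ω) = φ dΩ + dφ ∧ Ω`. -/
lemma extDerivTwo_mul
    {Ω : Π x : M, TangentSpace I x → TangentSpace I x → ℝ} {φ : M → ℝ}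
    {X Y Z : Π x : M, TangentSpace I x} {x : M} (hφ : MDifferentiableAt I 𝓘(ℝ, ℝ) φ x)
    (h1 : MDifferentiableAt I 𝓘(ℝ, ℝ) (fun y ↦ Ω y (X y) (Y y)) x)
    (h2 : MDifferentiableAt I 𝓘(ℝ, ℝ) (fun y ↦ Ω y (Y y) (Z y)) x)
    (h3 : MDifferentiableAt I 𝓘(ℝ, ℝ) (fun y ↦ Ω y (Z y) (X y)) x) :
    extDerivTwo I (fun x v w ↦ φ x * Ω x v w) X Y Z x = φ x * extDerivTwo I Ω X Y Z x
      + (mvfderiv I φ x (X x) * Ω x (Y x) (Z x) + mvfderiv I φ x (Y x) * Ω x (Z x) (X x)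
        + mvfderiv I φ x (Z x) * Ω x (X x) (Y x)) := by
  simp only [extDerivTwo, mvfderiv_fun_mul hφ h1, mvfderiv_fun_mul hφ h2, mvfderiv_fun_mul hφ h3,
    add_apply, smul_apply, smul_eq_mul]
  ring

end TwoForms

section OneForms

open VectorField

variable {E : Type*} [NormedAddCommGroup E] [NormedSpace ℝ E]
  {H : Type*} [TopologicalSpace H] (I : ModelWithCorners ℝ E H)
  {M : Type*} [TopologicalSpace M] [ChartedSpace H M] [IsManifold I ∞ M]

/-- `lam` is a smooth `1`-form with exterior derivative `del`. -/
structure HasExtDeriv (lam : Π x : M, TangentSpace I x →L[ℝ] ℝ)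
    (del : Π x : M, TangentSpace I x → TangentSpace I x → ℝ) : Prop where
  contMDiffAt : ∀ (X : Π x : M, TangentSpace I x) (x : M),
    ContMDiffAt I I.tangent ∞ (fun x ↦ (⟨x, X x⟩ : TangentBundle I M)) x →
      ContMDiffAt I 𝓘(ℝ, ℝ) ∞ (fun y ↦ lam y (X y)) x
  mdifferentiableAt : ∀ (X : Π x : M, TangentSpace I x) (x : M),
    MDifferentiableAt I I.tangent (fun x ↦ (⟨x, X x⟩ : TangentBundle I M)) x →
      MDifferentiableAt I 𝓘(ℝ, ℝ) (fun y ↦ lam y (X y)) x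
  apply_mlieBracket : ∀ (X Y : Π x : M, TangentSpace I x) (x : M),
    MDifferentiableAt I I.tangent (fun x ↦ (⟨x, X x⟩ : TangentBundle I M)) x →
    MDifferentiableAt I I.tangent (fun x ↦ (⟨x, Y x⟩ : TangentBundle I M)) x →
      lam x (mlieBracket I X Y x) = mvfderiv I (fun y ↦ lam y (Y y)) x (X x)
        - mvfderiv I (fun y ↦ lam y (X y)) x (Y x) - del x (X x) (Y x)

variable {I}

lemma hasExtDeriv_mvfderiv [CompleteSpace E] [I.Boundaryless]
    {f : M → ℝ} (hf : ContMDiff I 𝓘(ℝ, ℝ) ∞ f) :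
    HasExtDeriv I (fun x ↦ mvfderiv I f x) (fun _ _ _ ↦ 0) where
  contMDiffAt X x hX := contMDiffAt_mvfderiv_apply (hf x) hX
  mdifferentiableAt X x hX := mdifferentiableAt_mvfderiv_apply ((hf x).of_le ENat.LEInfty.out) hX
  apply_mlieBracket X Y x hX hY := by rw [mvfderiv_mlieBracket hf hX hY, sub_zero]

namespace HasExtDeriv

variable {lam mu : Π x : M, TangentSpace I x →L[ℝ] ℝ}
  {del eps : Π x : M, TangentSpace I x → TangentSpace I x → ℝ}

lemma congr (h : HasExtDeriv I lam del) (he : ∀ x v w, eps x v w = del x v w) :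
    HasExtDeriv I lam eps := by
  obtain rfl : eps = del := by ext x v w; exact he x v w
  exact h

lemma add (h : HasExtDeriv I lam del) (k : HasExtDeriv I mu eps) :
    HasExtDeriv I (fun x ↦ lam x + mu x) (fun x v w ↦ del x v w + eps x v w) where
  contMDiffAt X x hX := (h.contMDiffAt X x hX).add (k.contMDiffAt X x hX)
  mdifferentiableAt X x hX := (h.mdifferentiableAt X x hX).add (k.mdifferentiableAt X x hX)
  apply_mlieBracket X Y x hX hY := by
    have h1 := mvfderiv_fun_add (h.mdifferentiableAt X x hX) (k.mdifferentiableAt X x hX)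
    have h2 := mvfderiv_fun_add (h.mdifferentiableAt Y x hY) (k.mdifferentiableAt Y x hY)
    simp only [add_apply, h1, h2, h.apply_mlieBracket X Y x hX hY, k.apply_mlieBracket X Y x hX hY]
    ring

lemma smul {f : M → ℝ} (hf : ContMDiff I 𝓘(ℝ, ℝ) ∞ f) (h : HasExtDeriv I lam del) :
    HasExtDeriv I (fun x ↦ f x • lam x) (fun x v w ↦ f x * del x v w
      + (mvfderiv I f x v * lam x w - mvfderiv I f x w * lam x v)) where
  contMDiffAt X x hX := (hf x).mul (h.contMDiffAt X x hX)
  mdifferentiableAt X x hX := (hf.mdifferentiable (by simp) x).mul (h.mdifferentiableAt X x hX)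
  apply_mlieBracket X Y x hX hY := by
    have h1 := mvfderiv_fun_mul (hf.mdifferentiable (by simp) x) (h.mdifferentiableAt X x hX)
    have h2 := mvfderiv_fun_mul (hf.mdifferentiable (by simp) x) (h.mdifferentiableAt Y x hY)
    simp only [smul_apply, add_apply, smul_eq_mul, h1, h2, h.apply_mlieBracket X Y x hX hY]
    ring

/-- `d (lam ∧ mu) = d lam ∧ mu - lam ∧ d mu`. -/
lemma extDerivTwo_wedge [FiniteDimensional ℝ E]
    {X Y Z : Π x : M, TangentSpace I x} (h : HasExtDeriv I lam del) (k : HasExtDeriv I mu eps)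
    (hX : IsSmoothField I X) (hY : IsSmoothField I Y) (hZ : IsSmoothField I Z) (x : M) :
    extDerivTwo I (fun x v w ↦ lam x v * mu x w - lam x w * mu x v) X Y Z x =
      del x (X x) (Y x) * mu x (Z x) + del x (Y x) (Z x) * mu x (X x)
        + del x (Z x) (X x) * mu x (Y x)
      - (lam x (X x) * eps x (Y x) (Z x) + lam x (Y x) * eps x (Z x) (X x)
        + lam x (Z x) * eps x (X x) (Y x)) := by
  have md : ∀ {X : Π x : M, TangentSpace I x}, IsSmoothField I X →
      MDifferentiableAt I I.tangent (fun x ↦ (⟨x, X x⟩ : TangentBundle I M)) x :=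
    fun hX ↦ hX.mdifferentiable (by simp) x
  have hd : ∀ {X Y : Π x : M, TangentSpace I x}, IsSmoothField I X → IsSmoothField I Y →
      ∀ v, mvfderiv I (fun y ↦ lam y (X y) * mu y (Y y) - lam y (Y y) * mu y (X y)) x v =
        lam x (X x) * mvfderiv I (fun y ↦ mu y (Y y)) x v
        + mu x (Y x) * mvfderiv I (fun y ↦ lam y (X y)) x v
        - (lam x (Y x) * mvfderiv I (fun y ↦ mu y (X y)) x v
        + mu x (X x) * mvfderiv I (fun y ↦ lam y (Y y)) x v) := by
    intro X Y hX hY v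
    have l1 := h.mdifferentiableAt X x (md hX)
    have l2 := h.mdifferentiableAt Y x (md hY)
    have m1 := k.mdifferentiableAt X x (md hX)
    have m2 := k.mdifferentiableAt Y x (md hY)
    rw [mvfderiv_fun_sub (g := fun y ↦ lam y (X y) * mu y (Y y))
      (g' := fun y ↦ lam y (Y y) * mu y (X y)) (l1.mul m2)
      (l2.mul m1), mvfderiv_fun_mul l1 m2, mvfderiv_fun_mul l2 m1]
    rfl
  simp only [extDerivTwo, hd hX hY, hd hY hZ, hd hZ hX,
    h.apply_mlieBracket X Y x (md hX) (md hY), h.apply_mlieBracket Y Z x (md hY) (md hZ),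
    h.apply_mlieBracket Z X x (md hZ) (md hX), k.apply_mlieBracket X Y x (md hX) (md hY),
    k.apply_mlieBracket Y Z x (md hY) (md hZ), k.apply_mlieBracket Z X x (md hZ) (md hX)]
  ring

variable [CompleteSpace E]

lemma contMDiff_extDeriv {X Y : Π x : M, TangentSpace I x} (h : HasExtDeriv I lam del)
    (hX : IsSmoothField I X) (hY : IsSmoothField I Y) :
    ContMDiff I 𝓘(ℝ, ℝ) ∞ (fun y ↦ del y (X y) (Y y)) := by
  have h1 : IsManifold I ((⊤ : ℕ∞) + 1) M := inferInstanceAs (IsManifold I ∞ M)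
  have : IsManifold I (minSmoothness ℝ 2) M :=
    IsManifold.of_le (n := ∞) (by simpa using ENat.LEInfty.out)
  have h3 : IsSmoothField I (mlieBracket I X Y) := fun x ↦
    ContMDiffAt.mlieBracket_vectorField (n := ⊤) (m := ⊤) (hX x) (hY x) (by simp)
  have h2 : (fun y ↦ del y (X y) (Y y)) = fun y ↦ mvfderiv I (fun y ↦ lam y (Y y)) y (X y)
        - mvfderiv I (fun y ↦ lam y (X y)) y (Y y) - lam y (mlieBracket I X Y y) := by
    ext y
    rw [h.apply_mlieBracket X Y y (hX.mdifferentiable (by simp) y)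
      (hY.mdifferentiable (by simp) y)]
    ring
  rw [h2]
  exact fun x ↦ ((contMDiffAt_mvfderiv_apply (h.contMDiffAt Y x (hY x)) (hX x)).sub
    (contMDiffAt_mvfderiv_apply (h.contMDiffAt X x (hX x)) (hY x))).sub (h.contMDiffAt _ x (h3 x))

/-- `d (d lam) = 0`. -/
lemma extDerivTwo_eq_zero [FiniteDimensional ℝ E] [I.Boundaryless]
    {X Y Z : Π x : M, TangentSpace I x} (h : HasExtDeriv I lam del)
    (hX : IsSmoothField I X) (hY : IsSmoothField I Y) (hZ : IsSmoothField I Z) (x : M) :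
    extDerivTwo I del X Y Z x = 0 := by
  have h1 : IsManifold I ((⊤ : ℕ∞) + 1) M := inferInstanceAs (IsManifold I ∞ M)
  have : IsManifold I (minSmoothness ℝ 2) M :=
    IsManifold.of_le (n := ∞) (by simpa using ENat.LEInfty.out)
  have md : ∀ {X : Π x : M, TangentSpace I x}, IsSmoothField I X → ∀ y,
      MDifferentiableAt I I.tangent (fun x ↦ (⟨x, X x⟩ : TangentBundle I M)) y :=
    fun hX ↦ hX.mdifferentiable (by simp)
  have hl : ∀ {X Y : Π x : M, TangentSpace I x}, IsSmoothField I X → IsSmoothField I Y →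
      IsSmoothField I (mlieBracket I X Y) := fun hX hY x ↦
    ContMDiffAt.mlieBracket_vectorField (n := ⊤) (m := ⊤) (hX x) (hY x) (by simp)
  have hs : ∀ {X : Π x : M, TangentSpace I x}, IsSmoothField I X →
      ContMDiff I 𝓘(ℝ, ℝ) ∞ (fun y ↦ lam y (X y)) := fun hX x ↦ h.contMDiffAt _ x (hX x)
  have hd : ∀ {f : M → ℝ} {X : Π x : M, TangentSpace I x}, ContMDiff I 𝓘(ℝ, ℝ) ∞ f →
      IsSmoothField I X → ContMDiff I 𝓘(ℝ, ℝ) ∞ (fun y ↦ mvfderiv I f y (X y)) :=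
    fun hf hX x ↦ contMDiffAt_mvfderiv_apply (hf x) (hX x)
  have key : ∀ {X Y Z : Π x : M, TangentSpace I x}, IsSmoothField I X → IsSmoothField I Y →
      IsSmoothField I Z → mvfderiv I (fun y ↦ del y (Y y) (Z y)) x (X x) =
        mvfderiv I (fun y ↦ mvfderiv I (fun y ↦ lam y (Z y)) y (Y y)) x (X x)
        - mvfderiv I (fun y ↦ mvfderiv I (fun y ↦ lam y (Y y)) y (Z y)) x (X x)
        - mvfderiv I (fun y ↦ lam y (mlieBracket I Y Z y)) x (X x) := by
    intro X Y Z hX hY hZ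
    have h2 : (fun y ↦ del y (Y y) (Z y)) = fun y ↦ mvfderiv I (fun y ↦ lam y (Z y)) y (Y y)
        - mvfderiv I (fun y ↦ lam y (Y y)) y (Z y) - lam y (mlieBracket I Y Z y) := by
      ext y
      rw [h.apply_mlieBracket Y Z y (md hY y) (md hZ y)]
      ring
    rw [h2, mvfderiv_fun_sub, mvfderiv_fun_sub]
    · rfl
    · exact (hd (hs hZ) hY).mdifferentiable (by simp) x
    · exact (hd (hs hY) hZ).mdifferentiable (by simp) x
    · exact ((hd (hs hZ) hY).mdifferentiable (by simp) x).sub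
        ((hd (hs hY) hZ).mdifferentiable (by simp) x)
    · exact (hs (hl hY hZ)).mdifferentiable (by simp) x
  have key2 : ∀ {X Y Z : Π x : M, TangentSpace I x}, IsSmoothField I X → IsSmoothField I Y →
      IsSmoothField I Z → del x (mlieBracket I X Y x) (Z x) =
        mvfderiv I (fun y ↦ mvfderiv I (fun y ↦ lam y (Z y)) y (Y y)) x (X x)
        - mvfderiv I (fun y ↦ mvfderiv I (fun y ↦ lam y (Z y)) y (X y)) x (Y x)
        - mvfderiv I (fun y ↦ lam y (mlieBracket I X Y y)) x (Z x)
        - lam x (mlieBracket I (mlieBracket I X Y) Z x) := by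
    intro X Y Z hX hY hZ
    rw [h.apply_mlieBracket _ Z x (md (hl hX hY) x) (md hZ x),
      mvfderiv_mlieBracket (hs hZ) (md hX x) (md hY x)]
    ring
  have hm : ∀ {X : Π x : M, TangentSpace I x}, IsSmoothField I X →
      ContMDiffAt I I.tangent (minSmoothness ℝ 2) (fun x ↦ (⟨x, X x⟩ : TangentBundle I M)) x :=
    fun hX ↦ (hX x).of_le (by simpa using ENat.LEInfty.out)
  have h3 : IsManifold I (minSmoothness ℝ 3) M :=
    IsManifold.of_le (n := ∞) (by simpa using ENat.LEInfty.out)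
  have jac := congrArg (lam x) (leibniz_identity_mlieBracket_apply (hm hX) (hm hY) (hm hZ))
  rw [mlieBracket_swap_apply (V := X) (W := mlieBracket I Y Z),
    mlieBracket_swap (V := X) (W := Z),
    mlieBracket_swap_apply (V := Y) (W := -mlieBracket I Z X)] at jac
  have hneg : mlieBracket I (-mlieBracket I Z X) Y x = - mlieBracket I (mlieBracket I Z X) Y x := by
    have := mlieBracket_const_smul_left (I := I) (c := (-1 : ℝ)) (W := Y)
      (md (hl hZ hX) x)
    simpa using this
  rw [hneg] at jac
  simp only [map_add, map_neg, neg_neg] at jac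
  simp only [extDerivTwo, key hX hY hZ, key hY hZ hX, key hZ hX hY, key2 hX hY hZ, key2 hY hZ hX,
    key2 hZ hX hY]
  linarith

end HasExtDeriv

end OneForms
section Smoothness

open Bundle FiberBundle

variable {E : Type*} [NormedAddCommGroup E] [NormedSpace ℝ E] [FiniteDimensional ℝ E]
  {H : Type*} [TopologicalSpace H] {I : ModelWithCorners ℝ E H}
  {M : Type*} [TopologicalSpace M] [ChartedSpace H M]
  {F : Type*} [NormedAddCommGroup F] [NormedSpace ℝ F]

lemma contMDiffAt_clm_of_apply {A : M → E →L[ℝ] F} {x : M}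
    (hA : ∀ e : E, ContMDiffAt I 𝓘(ℝ, F) ∞ (fun y ↦ A y e) x) :
    ContMDiffAt I 𝓘(ℝ, E →L[ℝ] F) ∞ A x := by
  let b := Module.finBasis ℝ E
  have h : A = fun y ↦ ∑ i, ContinuousLinearMap.smulRightL ℝ E F
      (LinearMap.toContinuousLinearMap (b.coord i)) (A y (b i)) := by
    ext y e
    conv_lhs => rw [← b.sum_repr e, map_sum]
    simp
  rw [h]
  exact ContMDiffAt.sum fun i _ ↦
    (ContinuousLinearMap.contMDiff _).contMDiffAt.comp x (hA (b i))

variable [IsManifold I ∞ M]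

lemma contMDiffAt_hom_of_extend {V : M → Type*} [TopologicalSpace (TotalSpace F V)]
    [∀ x, AddCommGroup (V x)] [∀ x, Module ℝ (V x)] [∀ x, TopologicalSpace (V x)]
    [∀ x, IsTopologicalAddGroup (V x)] [∀ x, ContinuousSMul ℝ (V x)]
    [FiberBundle F V] [VectorBundle ℝ F V] {φ : Π x : M, TangentSpace I x →L[ℝ] V x} {x : M}
    (h : ∀ v : TangentSpace I x, ContMDiffAt I (I.prod 𝓘(ℝ, F)) ∞
      (fun y ↦ TotalSpace.mk' F y (φ y (extend E v y))) x) :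
    ContMDiffAt I (I.prod 𝓘(ℝ, E →L[ℝ] F)) ∞
      (fun y ↦ TotalSpace.mk' (E →L[ℝ] F) (E := fun x ↦ TangentSpace I x →L[ℝ] V x) y (φ y)) x := by
  rw [contMDiffAt_hom_bundle]
  refine ⟨contMDiffAt_id, contMDiffAt_clm_of_apply fun e ↦ ?_⟩
  set t := trivializationAt E (TangentSpace I) x with ht
  have h1 := ((contMDiffAt_section x).1 (h (t.symm x e)))
  refine h1.congr_of_eventuallyEq ?_
  have hb := t.open_baseSet.mem_nhds (mem_baseSet_trivializationAt E (TangentSpace I) x)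
  have hb' := (trivializationAt F V x).open_baseSet.mem_nhds (mem_baseSet_trivializationAt F V x)
  filter_upwards [hb, hb'] with y hy hy'
  rw [ContinuousLinearMap.inCoordinates_eq hy hy']
  have : extend E (t.symm x e) y = t.symm y e := by
    rw [extend, ← ht, t.apply_mk_symm (mem_baseSet_trivializationAt E (TangentSpace I) x)]
  rw [this]
  simp [ht]

lemma isSmoothField_of_immersion [FiniteDimensional ℝ F] {Φ : M → F} (hΦ : ContMDiff I 𝓘(ℝ, F) ∞ Φ)
    (hinj : ∀ x, Function.Injective (mvfderiv I Φ x)) {X : Π x : M, TangentSpace I x}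
    (hX : ContMDiff I 𝓘(ℝ, F) ∞ (fun x ↦ mvfderiv I Φ x (X x))) : IsSmoothField I X := by
  intro x
  set t := trivializationAt E (TangentSpace I) x with ht
  have hx := mem_baseSet_trivializationAt E (TangentSpace I) x
  rw [contMDiffAt_section]
  let A : M → E →L[ℝ] F := fun y ↦ (mvfderiv I Φ y).comp (t.symmL ℝ y)
  have hA : ContMDiffAt I 𝓘(ℝ, E →L[ℝ] F) ∞ A x := by
    refine contMDiffAt_clm_of_apply fun e ↦ ?_
    have h1 := contMDiffAt_mvfderiv_apply (hΦ x) (contMDiffAt_extend (k := ∞) I E (t.symm x e))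
    refine h1.congr_of_eventuallyEq ?_
    filter_upwards [t.open_baseSet.mem_nhds hx] with y hy
    have : extend E (t.symm x e) y = t.symm y e := by
      rw [extend, ← ht, t.apply_mk_symm hx]
    simp [A, this, t.symmL_apply hy]
  have hsymm : Function.Injective (t.symmL ℝ x) :=
    Function.LeftInverse.injective (t.continuousLinearMapAt_symmL hx)
  have hAinj : Function.Injective (A x) := (hinj x).comp hsymm
  obtain ⟨P, hP⟩ := (A x : E →ₗ[ℝ] F).exists_leftInverse_of_injective (LinearMap.ker_eq_bot.2 hAinj)
  let Q : F →L[ℝ] E := LinearMap.toContinuousLinearMap P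
  have hB : ContMDiffAt I 𝓘(ℝ, E →L[ℝ] E) ∞ (fun y ↦ Q.comp (A y)) x :=
    contMDiffAt_const.clm_comp hA
  have hBx : Q.comp (A x) = ((1 : (E →L[ℝ] E)ˣ) : E →L[ℝ] E) := by
    ext e
    exact congrArg (fun L ↦ L e) hP
  have : CompleteSpace E := FiniteDimensional.complete ℝ E
  have hinv : ContMDiffAt I 𝓘(ℝ, E →L[ℝ] E) ∞ (fun y ↦ Ring.inverse (Q.comp (A y))) x := by
    have h1 := contDiffAt_ringInverse ℝ (n := ∞) (1 : (E →L[ℝ] E)ˣ)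
    rw [← hBx] at h1
    exact h1.contMDiffAt.comp x hB
  have hQ : ContMDiffAt I 𝓘(ℝ, E) ∞ (fun y ↦ Q (mvfderiv I Φ y (X y))) x :=
    Q.contMDiff.contMDiffAt.comp x (hX x)
  refine (hinv.clm_apply hQ).congr_of_eventuallyEq ?_
  have hu : ∀ᶠ y in nhds x, IsUnit (Q.comp (A y)) := by
    refine hB.continuousAt.eventually (p := IsUnit) ?_
    change ∀ᶠ L in nhds (Q.comp (A x)), IsUnit L
    rw [hBx]
    exact Units.isOpen.mem_nhds (Units.isUnit _)
  filter_upwards [t.open_baseSet.mem_nhds hx, hu] with y hy hy'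
  have h1 : Q (mvfderiv I Φ y (X y)) = (Q.comp (A y)) (t ⟨y, X y⟩).2 := by
    simp only [A, ContinuousLinearMap.comp_apply]
    congr 2
    rw [t.symmL_apply hy, t.symm_apply_apply_mk hy]
  rw [h1]
  have h2 := congrArg (fun L : E →L[ℝ] E ↦ L (t ⟨y, X y⟩).2) (Ring.inverse_mul_cancel _ hy')
  exact h2.symm

end Smoothness
section Coframes

open Bundle FiberBundle VectorField

lemma mvfderiv_fun_sum {E : Type*} [NormedAddCommGroup E] [NormedSpace ℝ E]
    {H : Type*} [TopologicalSpace H] {I : ModelWithCorners ℝ E H}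
    {M : Type*} [TopologicalSpace M] [ChartedSpace H M] {ι : Type*} {s : Finset ι}
    {f : ι → M → ℝ} {x : M} (hf : ∀ i, MDifferentiableAt I 𝓘(ℝ, ℝ) (f i) x)
    (v : TangentSpace I x) :
    mvfderiv I (fun y ↦ ∑ i ∈ s, f i y) x v = ∑ i ∈ s, mvfderiv I (f i) x v := by
  classical
  suffices h : MDifferentiableAt I 𝓘(ℝ, ℝ) (fun y ↦ ∑ i ∈ s, f i y) x ∧
      mvfderiv I (fun y ↦ ∑ i ∈ s, f i y) x v = ∑ i ∈ s, mvfderiv I (f i) x v from h.2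
  induction s using Finset.induction_on with
  | empty => simp [mvfderiv_const, mdifferentiableAt_const]
  | insert i s hi ih =>
    simp only [Finset.sum_insert hi]
    refine ⟨(hf i).add ih.1, ?_⟩
    rw [mvfderiv_fun_add (hf i) ih.1, add_apply, ih.2]

variable {E : Type*} [NormedAddCommGroup E] [NormedSpace ℝ E]
  {H : Type*} [TopologicalSpace H] (I : ModelWithCorners ℝ E H)
  {M : Type*} [TopologicalSpace M] [ChartedSpace H M] [IsManifold I ∞ M]
  {ι : Type*} [Fintype ι] [DecidableEq ι]

/-- A global smooth coframe `ε`, with exterior derivatives `δ`, and its dual frame `e`. -/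
structure IsGlobalCoframe (ε : ι → Π x : M, TangentSpace I x →L[ℝ] ℝ)
    (δ : ι → Π x : M, TangentSpace I x → TangentSpace I x → ℝ)
    (e : ι → Π x : M, TangentSpace I x) : Prop where
  hasExtDeriv : ∀ i, HasExtDeriv I (ε i) (δ i)
  isSmoothField : ∀ i, IsSmoothField I (e i)
  apply_frame : ∀ i j x, ε i x (e j x) = if i = j then 1 else 0
  sum_smul : ∀ x (v : TangentSpace I x), ∑ i, ε i x v • e i x = v

namespace IsGlobalCoframe

variable {I} {ε : ι → Π x : M, TangentSpace I x →L[ℝ] ℝ}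
    {δ : ι → Π x : M, TangentSpace I x → TangentSpace I x → ℝ}
    {e : ι → Π x : M, TangentSpace I x}

lemma ext (h : IsGlobalCoframe I ε δ e) {x : M} {v w : TangentSpace I x}
    (hvw : ∀ i, ε i x v = ε i x w) : v = w := by
  rw [← h.sum_smul x v, ← h.sum_smul x w]
  simp [hvw]

lemma extDeriv_swap (h : IsGlobalCoframe I ε δ e) (k i j : ι) (x : M) :
    δ k x (e i x) (e j x) = -δ k x (e j x) (e i x) := by
  have md : ∀ i, MDifferentiableAt I I.tangent (fun x ↦ (⟨x, e i x⟩ : TangentBundle I M)) x :=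
    fun i ↦ (h.isSmoothField i).mdifferentiable (by simp) x
  have h1 := (h.hasExtDeriv k).apply_mlieBracket _ _ x (md i) (md j)
  have h2 := (h.hasExtDeriv k).apply_mlieBracket _ _ x (md j) (md i)
  rw [mlieBracket_swap_apply, map_neg] at h1
  linarith

lemma apply_mlieBracket_frame (h : IsGlobalCoframe I ε δ e) (k i j : ι) (x : M) :
    ε k x (mlieBracket I (e i) (e j) x) = -δ k x (e i x) (e j x) := by
  have md : ∀ i, MDifferentiableAt I I.tangent (fun x ↦ (⟨x, e i x⟩ : TangentBundle I M)) x :=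
    fun i ↦ (h.isSmoothField i).mdifferentiable (by simp) x
  rw [(h.hasExtDeriv k).apply_mlieBracket _ _ x (md i) (md j)]
  simp only [h.apply_frame, mvfderiv_const]
  simp

variable [FiniteDimensional ℝ E]

lemma isRiemannianMetric (h : IsGlobalCoframe I ε δ e) {c : ι → M → ℝ}
    (hc : ∀ i, ContMDiff I 𝓘(ℝ, ℝ) ∞ (c i)) (hpos : ∀ i x, 0 < c i x) :
    IsRiemannianMetric I (fun x v w ↦ ∑ i, c i x * (ε i x v * ε i x w)) := by
  let B : Π x : M, TangentSpace I x →L[ℝ] TangentSpace I x →L[ℝ] ℝ :=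
    fun x ↦ ∑ i, c i x • (ε i x).smulRight (ε i x)
  have hB : ∀ x v w, B x v w = ∑ i, c i x * (ε i x v * ε i x w) := by
    intro x v w
    simp [B]
  refine ⟨⟨B, ?_, ?_, ?_, ?_⟩, hB⟩
  · intro x v w
    simp only [hB]
    exact Finset.sum_congr rfl fun i _ ↦ by ring
  · intro x v hv
    rw [hB]
    obtain ⟨i, hi⟩ : ∃ i, ε i x v ≠ 0 := by
      by_contra! hcon
      exact hv (h.ext fun i ↦ by rw [hcon i, map_zero])
    refine Finset.sum_pos' (fun i _ ↦ mul_nonneg (hpos i x).le (mul_self_nonneg _))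
      ⟨i, Finset.mem_univ i, mul_pos (hpos i x) (mul_self_pos.2 hi)⟩
  · intro x
    let L : (ι → ℝ) →L[ℝ] TangentSpace I x :=
      ∑ i, (ContinuousLinearMap.proj (R := ℝ) i : (ι → ℝ) →L[ℝ] ℝ).smulRight (e i x)
    obtain ⟨C, hC0, hC⟩ : ∃ C : ℝ, 0 ≤ C ∧ ∀ i, (c i x)⁻¹ ≤ C := by
      obtain ⟨C, hC⟩ := (Set.finite_range fun i ↦ (c i x)⁻¹).bddAbove
      exact ⟨max C 0, le_max_right _ _, fun i ↦ (hC ⟨i, rfl⟩).trans (le_max_left _ _)⟩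
    have hb : Bornology.IsVonNBounded ℝ (Metric.closedBall (0 : ι → ℝ) (C + 1)) :=
      NormedSpace.isVonNBounded_closedBall ℝ _ _
    refine (hb.image L).subset fun v hv ↦ ?_
    refine ⟨fun i ↦ ε i x v, ?_, ?_⟩
    · simp only [Set.mem_ofPred_eq, hB] at hv
      rw [mem_closedBall_zero_iff, pi_norm_le_iff_of_nonneg (by linarith)]
      intro i
      have h1 : c i x * (ε i x v * ε i x v) ≤ ∑ i, c i x * (ε i x v * ε i x v) :=
        Finset.single_le_sum (f := fun i ↦ c i x * (ε i x v * ε i x v))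
          (fun i _ ↦ mul_nonneg (hpos i x).le (mul_self_nonneg _)) (Finset.mem_univ i)
      have h2 : (ε i x v) * (ε i x v) ≤ C := by
        refine le_trans ?_ (hC i)
        rw [← one_div, le_div_iff₀' (hpos i x)]
        linarith
      rw [Real.norm_eq_abs]
      refine abs_le_of_sq_le_sq ?_ (by linarith)
      nlinarith
    · simp only [L, sum_apply]
      exact h.sum_smul x v
  · intro x
    refine contMDiffAt_hom_of_extend fun v ↦ contMDiffAt_hom_of_extend (V := Trivial M ℝ) fun w ↦ ?_
    rw [contMDiffAt_section]
    have hv := contMDiffAt_extend (k := ∞) I E v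
    have hw := contMDiffAt_extend (k := ∞) I E w
    have h1 : ContMDiffAt I 𝓘(ℝ, ℝ) ∞ (fun y ↦ ∑ i, c i y * (ε i y (extend E v y)
        * ε i y (extend E w y))) x :=
      ContMDiffAt.sum fun i _ ↦ (hc i x).mul (((h.hasExtDeriv i).contMDiffAt _ x hv).mul
        ((h.hasExtDeriv i).contMDiffAt _ x hw))
    refine h1.congr_of_eventuallyEq (Filter.Eventually.of_forall fun y ↦ ?_)
    exact hB y _ _

variable (ε δ e) in
/-- The lowered Christoffel symbols `⟨∇_{e i} e j, e m⟩` of the metric `∑ w k • ε k ⊗ ε k`. -/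
noncomputable def christoffel (w : ι → ℝ) (m i j : ι) (x : M) : ℝ :=
  (-(w m * δ m x (e i x) (e j x)) + w i * δ i x (e j x) (e m x) - w j * δ j x (e m x) (e i x)) / 2

lemma exists_isLeviCivita (h : IsGlobalCoframe I ε δ e) {w : ι → ℝ} (hw : ∀ i, w i ≠ 0) :
    ∃ nabla : CovariantDerivative I E (fun x : M ↦ TangentSpace I x),
      IsLeviCivita I (fun x v v' ↦ ∑ i, w i * (ε i x v * ε i x v')) nabla ∧
      ∀ (Y : Π x : M, TangentSpace I x) (x : M) (v : TangentSpace I x) (m : ι),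
        ε m x (nabla Y x v) = mvfderiv I (fun y ↦ ε m y (Y y)) x v
          + ∑ i, ∑ j, ε i x v * ε j x (Y x) * ((w m)⁻¹ * christoffel δ e w m i j x) := by
  let D : (Π x : M, TangentSpace I x) → Π x : M, TangentSpace I x →L[ℝ] TangentSpace I x :=
    fun Y x ↦ ∑ m, (mvfderiv I (fun y ↦ ε m y (Y y)) x
      + ∑ i, (∑ j, ε j x (Y x) * ((w m)⁻¹ * christoffel δ e w m i j x)) • ε i x).smulRight (e m x)
  have hD : ∀ (Y : Π x : M, TangentSpace I x) (x : M) (v : TangentSpace I x) (m : ι),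
      ε m x (D Y x v) = mvfderiv I (fun y ↦ ε m y (Y y)) x v
        + ∑ i, ∑ j, ε i x v * ε j x (Y x) * ((w m)⁻¹ * christoffel δ e w m i j x) := by
    intro Y x v m
    simp only [D, sum_apply, map_sum, ContinuousLinearMap.smulRight_apply, map_smul, h.apply_frame,
      smul_eq_mul, mul_ite, mul_one, mul_zero, Finset.sum_ite_eq, Finset.mem_univ, if_true,
      add_apply, smul_apply, Finset.sum_mul]
    congr 1
    exact Finset.sum_congr rfl fun i _ ↦ Finset.sum_congr rfl fun j _ ↦ by ring
  have hcov : IsCovariantDerivativeOn E D Set.univ := by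
    constructor
    · intro Y Z x hY hZ _
      ext v
      refine h.ext fun m ↦ ?_
      have h1 := mvfderiv_fun_add ((h.hasExtDeriv m).mdifferentiableAt Y x hY)
        ((h.hasExtDeriv m).mdifferentiableAt Z x hZ)
      rw [add_apply, map_add, hD, hD, hD]
      simp only [Pi.add_apply, map_add, h1, add_apply, mul_add, add_mul, Finset.sum_add_distrib]
      ring
    · intro Y f x hY hf _
      ext v
      refine h.ext fun m ↦ ?_
      have h1 := mvfderiv_fun_mul hf ((h.hasExtDeriv m).mdifferentiableAt Y x hY)
      rw [add_apply, smul_apply, ContinuousLinearMap.smulRight_apply, map_add, map_smul, map_smul,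
        hD, hD]
      simp only [Pi.smul_apply', map_smul, smul_eq_mul, h1, add_apply, smul_apply, mul_add,
        Finset.mul_sum]
      have h2 : ∀ i j, ε i x v * (f x * ε j x (Y x)) * ((w m)⁻¹ * christoffel δ e w m i j x)
        = f x * (ε i x v * ε j x (Y x) * ((w m)⁻¹ * christoffel δ e w m i j x)) :=
        fun i j ↦ by ring
      simp only [h2]
      ring
  refine ⟨⟨D, hcov⟩, ⟨?_, ?_⟩, hD⟩
  · have : CompleteSpace E := FiniteDimensional.complete ℝ E
    have key : ∀ x i j, CovariantDerivative.torsion ⟨D, hcov⟩ x (e i x) (e j x) = 0 := by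
      intro x i j
      rw [CovariantDerivative.torsion_apply _ ((h.isSmoothField i).mdifferentiable (by simp) x)
        ((h.isSmoothField j).mdifferentiable (by simp) x)]
      refine h.ext fun m ↦ ?_
      rw [map_zero, map_sub, map_sub, hD, hD, h.apply_mlieBracket_frame]
      simp only [h.apply_frame, mvfderiv_const]
      simp only [mul_ite, ite_mul, one_mul, zero_mul, mul_zero, Finset.sum_ite_eq',
        Finset.mem_univ, if_true, zero_apply, zero_add, mul_one]
      have := hw m
      simp only [christoffel]
      rw [h.extDeriv_swap m j i, h.extDeriv_swap i j m, h.extDeriv_swap j i m]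
      field_simp
      ring
    ext x v v'
    rw [← h.sum_smul x v, ← h.sum_smul x v']
    simp [key]
  · intro X Y Z hX hY hZ x
    have md : ∀ {X : Π x : M, TangentSpace I x}, IsSmoothField I X → ∀ m,
        MDifferentiableAt I 𝓘(ℝ, ℝ) (fun y ↦ ε m y (X y)) x :=
      fun hX m ↦ (h.hasExtDeriv m).mdifferentiableAt _ x (hX.mdifferentiable (by simp) x)
    have h1 : mvfderiv I (fun y ↦ ∑ i, w i * (ε i y (Y y) * ε i y (Z y))) x (X x)
        = ∑ i, w i * (ε i x (Y x) * mvfderiv I (fun y ↦ ε i y (Z y)) x (X x)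
          + ε i x (Z x) * mvfderiv I (fun y ↦ ε i y (Y y)) x (X x)) := by
      have h0 := fun i ↦ mvfderiv_fun_mul (md hY i) (md hZ i)
      have hp : ∀ i, MDifferentiableAt I 𝓘(ℝ, ℝ) (fun y ↦ ε i y (Y y) * ε i y (Z y)) x :=
        fun i ↦ (md hY i).mul (md hZ i)
      have hq : ∀ i, MDifferentiableAt I 𝓘(ℝ, ℝ)
          (fun y ↦ w i * (ε i y (Y y) * ε i y (Z y))) x :=
        fun i ↦ MDifferentiableAt.mul (mdifferentiableAt_const (c := w i)) (hp i)
      rw [mvfderiv_fun_sum hq]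
      refine Finset.sum_congr rfl fun i _ ↦ ?_
      rw [mvfderiv_fun_mul mdifferentiableAt_const (hp i), mvfderiv_const, h0]
      simp only [add_apply, smul_apply, smul_zero, add_zero, smul_eq_mul]
    rw [h1]
    simp only [hD]
    have hS : ∀ m i j, christoffel δ e w m i j x = - christoffel δ e w j i m x := by
      intro m i j
      simp only [christoffel]
      rw [h.extDeriv_swap m i j, h.extDeriv_swap i j m, h.extDeriv_swap j m i]
      ring
    have h2 : ∑ m, ∑ i, ∑ j, ε i x (X x) * ε j x (Y x) * ε m x (Z x) * christoffel δ e w m i j x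
        = - ∑ m, ∑ i, ∑ j, ε i x (X x) * ε j x (Z x) * ε m x (Y x) * christoffel δ e w m i j x := by
      calc _ = ∑ i, ∑ m, ∑ j, ε i x (X x) * ε j x (Y x) * ε m x (Z x)
              * christoffel δ e w m i j x := Finset.sum_comm
        _ = ∑ i, ∑ j, ∑ m, ε i x (X x) * ε j x (Y x) * ε m x (Z x)
              * christoffel δ e w m i j x := Finset.sum_congr rfl fun i _ ↦ Finset.sum_comm
        _ = ∑ j, ∑ i, ∑ m, ε i x (X x) * ε j x (Y x) * ε m x (Z x)
              * christoffel δ e w m i j x := Finset.sum_comm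
        _ = _ := by
          rw [← Finset.sum_neg_distrib]
          refine Finset.sum_congr rfl fun j _ ↦ ?_
          rw [← Finset.sum_neg_distrib]
          refine Finset.sum_congr rfl fun i _ ↦ ?_
          rw [← Finset.sum_neg_distrib]
          refine Finset.sum_congr rfl fun m _ ↦ ?_
          rw [hS m i j]
          ring
    have h3 : ∀ (y z : ι → ℝ), ∑ m, w m * ((∑ i, ∑ j, ε i x (X x) * y j
        * ((w m)⁻¹ * christoffel δ e w m i j x)) * z m)
        = ∑ m, ∑ i, ∑ j, ε i x (X x) * y j * z m * christoffel δ e w m i j x := by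
      intro y z
      refine Finset.sum_congr rfl fun m _ ↦ ?_
      rw [Finset.sum_mul, Finset.mul_sum]
      refine Finset.sum_congr rfl fun i _ ↦ ?_
      rw [Finset.sum_mul, Finset.mul_sum]
      refine Finset.sum_congr rfl fun j _ ↦ ?_
      have := hw m
      field_simp
    have h4 := h3 (fun j ↦ ε j x (Y x)) (fun j ↦ ε j x (Z x))
    have h5 := h3 (fun j ↦ ε j x (Z x)) (fun j ↦ ε j x (Y x))
    have h6 : ∀ a b : ι → ℝ, ∑ m, w m * (ε m x (Y x) * mvfderiv I (fun y ↦ ε m y (Z y)) x (X x)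
          + ε m x (Z x) * mvfderiv I (fun y ↦ ε m y (Y y)) x (X x))
        + (∑ m, w m * (a m * ε m x (Z x)) + ∑ m, w m * (b m * ε m x (Y x)))
        = ∑ m, w m * ((mvfderiv I (fun y ↦ ε m y (Y y)) x (X x) + a m) * ε m x (Z x))
        + ∑ m, w m * (ε m x (Y x) * (mvfderiv I (fun y ↦ ε m y (Z y)) x (X x) + b m)) := by
      intro a b
      simp only [← Finset.sum_add_distrib]
      exact Finset.sum_congr rfl fun m _ ↦ by ring
    rw [← h6, h4, h5, h2, neg_add_cancel, add_zero]

end IsGlobalCoframe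

end Coframes
section Conformal

open VectorField

variable {E : Type*} [NormedAddCommGroup E] [NormedSpace ℝ E] [FiniteDimensional ℝ E]
  {H : Type*} [TopologicalSpace H] {I : ModelWithCorners ℝ E H} [I.Boundaryless]
  {M : Type*} [TopologicalSpace M] [ChartedSpace H M] [IsManifold I ∞ M]

/-- If `Ω = dσ + α ∧ σ` with `α` closed, then `d (e^{-f} Ω) = -e^{-f} (df + α) ∧ Ω`. -/
lemma extDerivTwo_exp_mul {α σ : Π x : M, TangentSpace I x →L[ℝ] ℝ}
    {del Ω : Π x : M, TangentSpace I x → TangentSpace I x → ℝ}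
    (hα : HasExtDeriv I α (fun _ _ _ ↦ 0)) (hσ : HasExtDeriv I σ del)
    (hΩ : ∀ x v w, Ω x v w = del x v w + (α x v * σ x w - α x w * σ x v))
    {f : M → ℝ} {x : M} (hf : MDifferentiableAt I 𝓘(ℝ, ℝ) f x)
    {X Y Z : Π x : M, TangentSpace I x}
    (hX : IsSmoothField I X) (hY : IsSmoothField I Y) (hZ : IsSmoothField I Z) :
    extDerivTwo I (fun x v w ↦ Real.exp (-f x) * Ω x v w) X Y Z x =
      -(Real.exp (-f x) * ((mvfderiv I f x (X x) + α x (X x)) * Ω x (Y x) (Z x)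
        + (mvfderiv I f x (Y x) + α x (Y x)) * Ω x (Z x) (X x)
        + (mvfderiv I f x (Z x) + α x (Z x)) * Ω x (X x) (Y x))) := by
  have : CompleteSpace E := FiniteDimensional.complete ℝ E
  obtain rfl : Ω = fun x v w ↦ del x v w + (α x v * σ x w - α x w * σ x v) := by
    ext x v w; exact hΩ x v w
  have hdel : ∀ {X Y : Π x : M, TangentSpace I x}, IsSmoothField I X → IsSmoothField I Y →
      MDifferentiableAt I 𝓘(ℝ, ℝ) (fun y ↦ del y (X y) (Y y)) x :=
    fun hX hY ↦ (hσ.contMDiff_extDeriv hX hY).mdifferentiable (by simp) x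
  have hw : ∀ {X Y : Π x : M, TangentSpace I x}, IsSmoothField I X → IsSmoothField I Y →
      MDifferentiableAt I 𝓘(ℝ, ℝ) (fun y ↦ α y (X y) * σ y (Y y) - α y (Y y) * σ y (X y)) x := by
    intro X Y hX hY
    have hX' := hX.mdifferentiable (by simp) x
    have hY' := hY.mdifferentiable (by simp) x
    exact ((hα.mdifferentiableAt X x hX').mul (hσ.mdifferentiableAt Y x hY')).sub
      ((hα.mdifferentiableAt Y x hY').mul (hσ.mdifferentiableAt X x hX'))
  have h1 : HasFDerivAt (fun t : ℝ ↦ Real.exp (-t))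
      (ContinuousLinearMap.toSpanSingleton ℝ (-Real.exp (-f x))) (f x) := by
    simpa using (hasDerivAt_neg (f x)).exp.hasFDerivAt
  have hexp := h1.hasMFDerivAt.comp x hf.hasMFDerivAt
  have hφ : ∀ v, mvfderiv I (fun y ↦ Real.exp (-f y)) x v
      = mvfderiv I f x v * -Real.exp (-f x) :=
    fun v ↦ congrArg (fun L ↦ L v) hexp.mfderiv
  rw [extDerivTwo_mul (φ := fun y ↦ Real.exp (-f y)) hexp.mdifferentiableAt
      ((hdel hX hY).add (hw hX hY))
    ((hdel hY hZ).add (hw hY hZ)) ((hdel hZ hX).add (hw hZ hX)),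
    extDerivTwo_add (hdel hX hY) (hdel hY hZ) (hdel hZ hX) (hw hX hY) (hw hY hZ) (hw hZ hX),
    hσ.extDerivTwo_eq_zero hX hY hZ, hα.extDerivTwo_wedge hσ hX hY hZ]
  simp only [hφ]
  ring

end Conformal
end LCK

namespace HopfMetric

open LCK Bundle

lemma mvfderiv_clm_comp {F F' : Type*} [NormedAddCommGroup F] [NormedSpace ℝ F]
    [NormedAddCommGroup F'] [NormedSpace ℝ F'] (L : F →L[ℝ] F') {f : S1S3 → F} {p : S1S3}
    (hf : MDifferentiableAt mdl 𝓘(ℝ, F) f p) (v : TangentSpace mdl p) :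
    mvfderiv mdl (fun q ↦ L (f q)) p v = L (mvfderiv mdl f p v) := by
  have h := (L.hasMFDerivAt (x := f p)).comp p hf.hasMFDerivAt
  exact congrArg (fun K ↦ K v) h.mfderiv

lemma contMDiff_circle : ContMDiff mdl 𝓘(ℝ, ℂ) ∞ (fun q : S1S3 ↦ (q.1 : ℂ)) := by
  have := finrank_real_complex_fact'
  have h1 : ContMDiff (𝓡 1) 𝓘(ℝ, ℂ) ∞ (fun z : Circle ↦ (z : ℂ)) :=
    contMDiff_coe_sphere (E := ℂ) (n := 1)
  exact h1.comp (contMDiff_fst (I := 𝓡 1) (J := 𝓡 3))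

lemma contMDiff_sphere : ContMDiff mdl 𝓘(ℝ, R4) ∞ (fun q : S1S3 ↦ (q.2 : R4)) := by
  have : Fact (Module.finrank ℝ R4 = 3 + 1) := ⟨by simp⟩
  have h1 : ContMDiff (𝓡 3) 𝓘(ℝ, R4) ∞ (fun z : S3 ↦ (z : R4)) :=
    contMDiff_coe_sphere (E := R4) (n := 3)
  exact h1.comp (contMDiff_snd (I := 𝓡 1) (J := 𝓡 3))

/-- The real coordinates of `ℂ²`, as functions on `S¹ × S³`. -/
def coord (i : Fin 4) (p : S1S3) : ℝ := (p.2 : R4) i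

lemma contMDiff_coord (i : Fin 4) : ContMDiff mdl 𝓘(ℝ, ℝ) ∞ (coord i) :=
  (EuclideanSpace.proj (𝕜 := ℝ) i).contMDiff.comp contMDiff_sphere

lemma mvfderiv_coord (i : Fin 4) (p : S1S3) (v : TangentSpace mdl p) :
    mvfderiv mdl (coord i) p v = dSphere p v i :=
  mvfderiv_clm_comp (EuclideanSpace.proj (𝕜 := ℝ) i) (mdifferentiableAt_sphere p) v

lemma coord_sq_sum (p : S1S3) :
    coord 0 p ^ 2 + coord 1 p ^ 2 + coord 2 p ^ 2 + coord 3 p ^ 2 = 1 := S3_sq_sum p.2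

lemma dSphere_eq (p : S1S3) (v : TangentSpace mdl p) :
    dSphere p v = coframe p v 1 • quatI p.2 + coframe p v 2 • quatJ p.2
      + coframe p v 3 • quatK p.2 := by
  conv_lhs => rw [← sum_coframe_smul_frame p v]
  rw [Fin.sum_univ_four, map_add, map_add, map_add, map_smul, map_smul, map_smul, map_smul,
    dSphere_frame, dSphere_frame, dSphere_frame, dSphere_frame]
  simp

lemma dCircle_eq (p : S1S3) (v : TangentSpace mdl p) :
    dCircle p v = coframe p v 0 * (Complex.I * (p.1 : ℂ)) := by
  conv_lhs => rw [← sum_coframe_smul_frame p v]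
  rw [Fin.sum_univ_four, map_add, map_add, map_add, map_smul, map_smul, map_smul, map_smul,
    dCircle_frame, dCircle_frame, dCircle_frame, dCircle_frame]
  simp

end HopfMetric

namespace LCK

section Calculus

variable {E : Type*} [NormedAddCommGroup E] [NormedSpace ℝ E]
  {H : Type*} [TopologicalSpace H] {I : ModelWithCorners ℝ E H}
  {M : Type*} [TopologicalSpace M] [ChartedSpace H M]

lemma mvfderiv_real_comp {φ : ℝ → ℝ} {φ' : ℝ} {f : M → ℝ} {x : M} (hφ : HasDerivAt φ φ' (f x))
    (hf : MDifferentiableAt I 𝓘(ℝ, ℝ) f x) (v : TangentSpace I x) :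
    mvfderiv I (fun y ↦ φ (f y)) x v = φ' * mvfderiv I f x v := by
  have h := hφ.hasFDerivAt.hasMFDerivAt.comp x hf.hasMFDerivAt
  exact (congrArg (fun L ↦ L v) h.mfderiv).trans (mul_comm (mvfderiv I f x v) φ')

lemma mvfderiv_mul_apply {f g : M → ℝ} {x : M} (hf : MDifferentiableAt I 𝓘(ℝ, ℝ) f x)
    (hg : MDifferentiableAt I 𝓘(ℝ, ℝ) g x) (v : TangentSpace I x) :
    mvfderiv I (fun y ↦ f y * g y) x v = f x * mvfderiv I g x v + g x * mvfderiv I f x v := by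
  rw [mvfderiv_fun_mul hf hg]
  rfl

lemma mvfderiv_add_apply {f g : M → ℝ} {x : M} (hf : MDifferentiableAt I 𝓘(ℝ, ℝ) f x)
    (hg : MDifferentiableAt I 𝓘(ℝ, ℝ) g x) (v : TangentSpace I x) :
    mvfderiv I (fun y ↦ f y + g y) x v = mvfderiv I f x v + mvfderiv I g x v := by
  rw [mvfderiv_fun_add hf hg]
  rfl

lemma mvfderiv_sub_apply {f g : M → ℝ} {x : M} (hf : MDifferentiableAt I 𝓘(ℝ, ℝ) f x)
    (hg : MDifferentiableAt I 𝓘(ℝ, ℝ) g x) (v : TangentSpace I x) :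
    mvfderiv I (fun y ↦ f y - g y) x v = mvfderiv I f x v - mvfderiv I g x v := by
  rw [mvfderiv_fun_sub hf hg]
  rfl

lemma mvfderiv_const_mul_apply {f : M → ℝ} {x : M} (c : ℝ) (hf : MDifferentiableAt I 𝓘(ℝ, ℝ) f x)
    (v : TangentSpace I x) :
    mvfderiv I (fun y ↦ c * f y) x v = c * mvfderiv I f x v :=
  mvfderiv_real_comp (φ := fun t ↦ c * t) (by simpa using (hasDerivAt_id (f x)).const_mul c) hf v

lemma hasExtDeriv_rotation [IsManifold I ∞ M] [CompleteSpace E] [I.Boundaryless] {f g : M → ℝ}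
    (hf : ContMDiff I 𝓘(ℝ, ℝ) ∞ f) (hg : ContMDiff I 𝓘(ℝ, ℝ) ∞ g) :
    HasExtDeriv I (fun x ↦ f x • mvfderiv I g x + (-1 * g x) • mvfderiv I f x)
      (fun x v w ↦ 2 * (mvfderiv I f x v * mvfderiv I g x w
        - mvfderiv I f x w * mvfderiv I g x v)) := by
  have hg' : ContMDiff I 𝓘(ℝ, ℝ) ∞ (fun x ↦ -1 * g x) := contMDiff_const.mul hg
  refine (((hasExtDeriv_mvfderiv hg).smul hf).add ((hasExtDeriv_mvfderiv hf).smul hg')).congr ?_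
  intro x v w
  simp only [mvfderiv_const_mul_apply (-1) (hg.mdifferentiable (by simp) x)]
  ring

end Calculus
end LCK

namespace HopfMetric

open LCK Bundle

/-- The coframe `e¹, e², e³, e⁴` as continuous linear forms. -/
noncomputable def coform (j : Fin 4) (p : S1S3) : TangentSpace mdl p →L[ℝ] ℝ :=
  (![(innerSL ℝ (Complex.I * (p.1 : ℂ))).comp (dCircle p),
    (innerSL ℝ (quatI p.2)).comp (dSphere p),
    (innerSL ℝ (quatJ p.2)).comp (dSphere p),
    (innerSL ℝ (quatK p.2)).comp (dSphere p)] : Fin 4 → TangentSpace mdl p →L[ℝ] ℝ) j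

lemma coform_apply (j : Fin 4) (p : S1S3) (v : TangentSpace mdl p) :
    coform j p v = coframe p v j := by
  fin_cases j <;> rfl

lemma mvfderiv_coord_coform (p : S1S3) (v : TangentSpace mdl p) :
    mvfderiv mdl (coord 0) p v
      = -coord 1 p * coform 1 p v - coord 2 p * coform 2 p v - coord 3 p * coform 3 p v ∧
    mvfderiv mdl (coord 1) p v
      = coord 0 p * coform 1 p v + coord 3 p * coform 2 p v - coord 2 p * coform 3 p v ∧
    mvfderiv mdl (coord 2) p v
      = -coord 3 p * coform 1 p v + coord 0 p * coform 2 p v + coord 1 p * coform 3 p v ∧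
    mvfderiv mdl (coord 3) p v
      = coord 2 p * coform 1 p v - coord 1 p * coform 2 p v + coord 0 p * coform 3 p v := by
  simp only [mvfderiv_coord, coform_apply, dSphere_eq]
  refine ⟨?_, ?_, ?_, ?_⟩ <;> simp [quatI, quatJ, quatK, coord] <;> ring

lemma mdifferentiableAt_coord (i : Fin 4) (p : S1S3) :
    MDifferentiableAt mdl 𝓘(ℝ, ℝ) (coord i) p :=
  (contMDiff_coord i).mdifferentiable (by simp) p

lemma contMDiff_circle_clm (L : ℂ →L[ℝ] ℝ) : ContMDiff mdl 𝓘(ℝ, ℝ) ∞ (fun q : S1S3 ↦ L q.1) :=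
  L.contMDiff.comp contMDiff_circle

lemma hasExtDeriv_coform_zero : HasExtDeriv mdl (coform 0) (fun _ _ _ ↦ 0) := by
  have h := hasExtDeriv_rotation (I := mdl) (contMDiff_circle_clm Complex.reCLM)
    (contMDiff_circle_clm Complex.imCLM)
  have hr : ∀ p v, mvfderiv mdl (fun q : S1S3 ↦ Complex.reCLM q.1) p v = (dCircle p v).re :=
    fun p v ↦ mvfderiv_clm_comp Complex.reCLM (mdifferentiableAt_circle p) v
  have hi : ∀ p v, mvfderiv mdl (fun q : S1S3 ↦ Complex.imCLM q.1) p v = (dCircle p v).im :=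
    fun p v ↦ mvfderiv_clm_comp Complex.imCLM (mdifferentiableAt_circle p) v
  convert! h using 1
  · ext p v
    rw [add_apply, smul_apply, smul_apply, hr, hi, coform_apply]
    simp [coframe]
    ring
  · ext p v w
    rw [hr, hi, hr, hi, dCircle_eq, dCircle_eq]
    simp
    ring

lemma hasExtDeriv_coform_one : HasExtDeriv mdl (coform 1)
    (fun p v w ↦ 2 * (coform 2 p v * coform 3 p w - coform 2 p w * coform 3 p v)) := by
  have h := (hasExtDeriv_rotation (I := mdl) (contMDiff_coord 0) (contMDiff_coord 1)).add
    (hasExtDeriv_rotation (contMDiff_coord 2) (contMDiff_coord 3))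
  convert! h using 1
  · ext p v
    simp only [add_apply, smul_apply, coform_apply, mvfderiv_coord]
    simp [coframe, quatI, coord, PiLp.inner_apply, Fin.sum_univ_four]
    ring
  · ext p v w
    obtain ⟨h0, h1, h2, h3⟩ := mvfderiv_coord_coform p v
    obtain ⟨k0, k1, k2, k3⟩ := mvfderiv_coord_coform p w
    rw [h0, h1, h2, h3, k0, k1, k2, k3]
    linear_combination (-2 * (coform 2 p v * coform 3 p w - coform 2 p w * coform 3 p v))
      * coord_sq_sum p

lemma hasExtDeriv_coform_two : HasExtDeriv mdl (coform 2)
    (fun p v w ↦ 2 * (coform 3 p v * coform 1 p w - coform 3 p w * coform 1 p v)) := by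
  have h := (hasExtDeriv_rotation (I := mdl) (contMDiff_coord 0) (contMDiff_coord 2)).add
    (hasExtDeriv_rotation (contMDiff_coord 3) (contMDiff_coord 1))
  convert! h using 1
  · ext p v
    simp only [add_apply, smul_apply, coform_apply, mvfderiv_coord]
    simp [coframe, quatJ, coord, PiLp.inner_apply, Fin.sum_univ_four]
    ring
  · ext p v w
    obtain ⟨h0, h1, h2, h3⟩ := mvfderiv_coord_coform p v
    obtain ⟨k0, k1, k2, k3⟩ := mvfderiv_coord_coform p w
    rw [h0, h1, h2, h3, k0, k1, k2, k3]
    linear_combination (-2 * (coform 3 p v * coform 1 p w - coform 3 p w * coform 1 p v))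
      * coord_sq_sum p

lemma hasExtDeriv_coform_three : HasExtDeriv mdl (coform 3)
    (fun p v w ↦ 2 * (coform 1 p v * coform 2 p w - coform 1 p w * coform 2 p v)) := by
  have h := (hasExtDeriv_rotation (I := mdl) (contMDiff_coord 0) (contMDiff_coord 3)).add
    (hasExtDeriv_rotation (contMDiff_coord 1) (contMDiff_coord 2))
  convert! h using 1
  · ext p v
    simp only [add_apply, smul_apply, coform_apply, mvfderiv_coord]
    simp [coframe, quatK, coord, PiLp.inner_apply, Fin.sum_univ_four]
    ring
  · ext p v w
    obtain ⟨h0, h1, h2, h3⟩ := mvfderiv_coord_coform p v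
    obtain ⟨k0, k1, k2, k3⟩ := mvfderiv_coord_coform p w
    rw [h0, h1, h2, h3, k0, k1, k2, k3]
    linear_combination (-2 * (coform 1 p v * coform 2 p w - coform 1 p w * coform 2 p v))
      * coord_sq_sum p

/-- `‖ξ₁‖²`. -/
noncomputable def modSq (p : S1S3) : ℝ := coord 0 p * coord 0 p + coord 1 p * coord 1 p

/-- The real part of `ξ₁ ξ₂`. -/
noncomputable def prodRe (p : S1S3) : ℝ := coord 0 p * coord 2 p - coord 1 p * coord 3 p

/-- The imaginary part of `ξ₁ ξ₂`. -/
noncomputable def prodIm (p : S1S3) : ℝ := coord 0 p * coord 3 p + coord 1 p * coord 2 p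

lemma contMDiff_modSq : ContMDiff mdl 𝓘(ℝ, ℝ) ∞ modSq :=
  ((contMDiff_coord 0).mul (contMDiff_coord 0)).add ((contMDiff_coord 1).mul (contMDiff_coord 1))

lemma contMDiff_prodRe : ContMDiff mdl 𝓘(ℝ, ℝ) ∞ prodRe :=
  ((contMDiff_coord 0).mul (contMDiff_coord 2)).sub ((contMDiff_coord 1).mul (contMDiff_coord 3))

lemma contMDiff_prodIm : ContMDiff mdl 𝓘(ℝ, ℝ) ∞ prodIm :=
  ((contMDiff_coord 0).mul (contMDiff_coord 3)).add ((contMDiff_coord 1).mul (contMDiff_coord 2))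

lemma mvfderiv_modSq (p : S1S3) (v : TangentSpace mdl p) : mvfderiv mdl modSq p v
    = -2 * (prodRe p * coform 2 p v + prodIm p * coform 3 p v) := by
  have hc := mdifferentiableAt_coord (p := p)
  have h : mvfderiv mdl modSq p v = _ := mvfderiv_add_apply
    (f := fun q ↦ coord 0 q * coord 0 q) (g := fun q ↦ coord 1 q * coord 1 q)
    ((hc 0).mul (hc 0)) ((hc 1).mul (hc 1)) v
  obtain ⟨h0, h1, h2, h3⟩ := mvfderiv_coord_coform p v
  rw [h, mvfderiv_mul_apply (hc 0) (hc 0), mvfderiv_mul_apply (hc 1) (hc 1), h0, h1, prodRe, prodIm]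
  ring

lemma mvfderiv_prodRe (p : S1S3) (v : TangentSpace mdl p) : mvfderiv mdl prodRe p v
    = -2 * prodIm p * coform 1 p v + (2 * modSq p - 1) * coform 2 p v := by
  have hc := mdifferentiableAt_coord (p := p)
  have h : mvfderiv mdl prodRe p v = _ := mvfderiv_sub_apply
    (f := fun q ↦ coord 0 q * coord 2 q) (g := fun q ↦ coord 1 q * coord 3 q)
    ((hc 0).mul (hc 2)) ((hc 1).mul (hc 3)) v
  obtain ⟨h0, h1, h2, h3⟩ := mvfderiv_coord_coform p v
  rw [h, mvfderiv_mul_apply (hc 0) (hc 2), mvfderiv_mul_apply (hc 1) (hc 3), h0, h1, h2, h3,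
    modSq, prodIm]
  linear_combination -coform 2 p v * coord_sq_sum p

lemma mvfderiv_prodIm (p : S1S3) (v : TangentSpace mdl p) : mvfderiv mdl prodIm p v
    = 2 * prodRe p * coform 1 p v + (2 * modSq p - 1) * coform 3 p v := by
  have hc := mdifferentiableAt_coord (p := p)
  have h : mvfderiv mdl prodIm p v = _ := mvfderiv_add_apply
    (f := fun q ↦ coord 0 q * coord 3 q) (g := fun q ↦ coord 1 q * coord 2 q)
    ((hc 0).mul (hc 3)) ((hc 1).mul (hc 2)) v
  obtain ⟨h0, h1, h2, h3⟩ := mvfderiv_coord_coform p v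
  rw [h, mvfderiv_mul_apply (hc 0) (hc 3), mvfderiv_mul_apply (hc 1) (hc 2), h0, h1, h2, h3,
    modSq, prodRe]
  linear_combination -coform 3 p v * coord_sq_sum p

lemma prodRe_sq_add_prodIm_sq (p : S1S3) :
    prodRe p ^ 2 + prodIm p ^ 2 = modSq p * (1 - modSq p) := by
  simp only [prodRe, prodIm, modSq]
  linear_combination (coord 0 p ^ 2 + coord 1 p ^ 2) * coord_sq_sum p

lemma xi1_mul_xi2 (p : S1S3) : xi1 p * xi2 p = prodRe p + prodIm p * Complex.I := by
  apply Complex.ext <;> simp [xi1, xi2, prodRe, prodIm, coord]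

lemma norm_xi1_sq (p : S1S3) : ‖xi1 p‖ ^ 2 = modSq p := by
  rw [← Complex.normSq_eq_norm_sq]
  simp [Complex.normSq_apply, xi1, modSq, coord]

lemma norm_xi2_sq (p : S1S3) : ‖xi2 p‖ ^ 2 = 1 - modSq p := by
  rw [← Complex.normSq_eq_norm_sq]
  have := coord_sq_sum p
  simp only [coord] at this
  simp only [Complex.normSq_apply, xi2, modSq, coord]
  linarith

lemma modSq_nonneg (p : S1S3) : 0 ≤ modSq p := norm_xi1_sq p ▸ sq_nonneg _

lemma modSq_le_one (p : S1S3) : modSq p ≤ 1 := by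
  have := norm_xi2_sq p ▸ sq_nonneg ‖xi2 p‖
  linarith

/-- The real part of `G`. -/
noncomputable def reG (a b : ℂ) (p : S1S3) : ℝ := b.re + (a.re - b.re) * modSq p

/-- The imaginary part of `G`, divided by `2π`. -/
noncomputable def imG (a b : ℂ) (p : S1S3) : ℝ :=
  b.im / (2 * Real.pi) + (a.im - b.im) / (2 * Real.pi) * modSq p

lemma G_re (a b : ℂ) (p : S1S3) : (G a b p).re = reG a b p := by
  simp only [G, norm_xi1_sq, norm_xi2_sq, reG]
  simp [-Complex.ofReal_sub]
  ring

lemma G_im (a b : ℂ) (p : S1S3) : (G a b p).im = 2 * Real.pi * imG a b p := by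
  have := Real.pi_ne_zero
  simp only [G, norm_xi1_sq, norm_xi2_sq, imG]
  simp [-Complex.ofReal_sub]
  field_simp
  ring

lemma reG_pos {a b : ℂ} (ha : 0 < a.re) (hb : 0 < b.re) (p : S1S3) : 0 < reG a b p := by
  have h0 := modSq_nonneg p
  have h1 := modSq_le_one p
  simp only [reG]
  rcases h0.eq_or_lt with h | h
  · rw [← h]; simpa using hb
  · nlinarith [mul_pos h ha, mul_nonneg (sub_nonneg.2 h1) hb.le]

lemma contMDiff_reG (a b : ℂ) : ContMDiff mdl 𝓘(ℝ, ℝ) ∞ (reG a b) :=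
  contMDiff_const.add (contMDiff_const.mul contMDiff_modSq)

lemma contMDiff_imG (a b : ℂ) : ContMDiff mdl 𝓘(ℝ, ℝ) ∞ (imG a b) :=
  contMDiff_const.add (contMDiff_const.mul contMDiff_modSq)

lemma mvfderiv_affine_modSq (c d : ℝ) (p : S1S3) (v : TangentSpace mdl p) :
    mvfderiv mdl (fun q ↦ c + d * modSq q) p v = d * mvfderiv mdl modSq p v :=
  mvfderiv_real_comp (φ := fun t ↦ c + d * t)
    (by simpa using ((hasDerivAt_id (modSq p)).const_mul d).const_add c)
    (contMDiff_modSq.mdifferentiable (by simp) p) v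

lemma mvfderiv_reG (a b : ℂ) (p : S1S3) (v : TangentSpace mdl p) :
    mvfderiv mdl (reG a b) p v = (a.re - b.re) * mvfderiv mdl modSq p v :=
  mvfderiv_affine_modSq _ _ p v

lemma mvfderiv_imG (a b : ℂ) (p : S1S3) (v : TangentSpace mdl p) :
    mvfderiv mdl (imG a b) p v = (a.im - b.im) / (2 * Real.pi) * mvfderiv mdl modSq p v :=
  mvfderiv_affine_modSq _ _ p v

end HopfMetric

namespace HopfMetric

open LCK Bundle

variable {a b : ℂ}

/-- `log (α / β)` has imaginary part `2π • slope a b`. -/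
noncomputable def slope (a b : ℂ) : ℝ := (a.im - b.im) / (2 * Real.pi)

variable (a b) in
/-- The `1`-form `(e² + Im G / 2π • e¹) / Re G`. -/
noncomputable def tau (p : S1S3) : TangentSpace mdl p →L[ℝ] ℝ :=
  (reG a b p)⁻¹ • (coform 1 p + imG a b p • coform 0 p)

variable (a b) in
/-- The real part of the component of a tangent vector along `e₃`, orthogonally to `e₂`. -/
noncomputable def yRe (p : S1S3) : TangentSpace mdl p →L[ℝ] ℝ :=
  coform 2 p + ((slope a b * prodIm p) • coform 0 p + (-(a.re - b.re) * prodIm p) • tau a b p)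

variable (a b) in
/-- The imaginary part of the component of a tangent vector along `e₃`, orthogonally to `e₂`. -/
noncomputable def yIm (p : S1S3) : TangentSpace mdl p →L[ℝ] ℝ :=
  coform 3 p + ((-slope a b * prodRe p) • coform 0 p + ((a.re - b.re) * prodRe p) • tau a b p)

lemma tau_apply (p : S1S3) (v : TangentSpace mdl p) :
    tau a b p v = (reG a b p)⁻¹ * (coform 1 p v + imG a b p * coform 0 p v) := rfl

lemma yRe_apply (p : S1S3) (v : TangentSpace mdl p) :
    yRe a b p v = coform 2 p v + (slope a b * prodIm p * coform 0 p v
      + -(a.re - b.re) * prodIm p * tau a b p v) := rfl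

lemma yIm_apply (p : S1S3) (v : TangentSpace mdl p) :
    yIm a b p v = coform 3 p v + (-slope a b * prodRe p * coform 0 p v
      + (a.re - b.re) * prodRe p * tau a b p v) := rfl

lemma contMDiff_inv_reG (hR : ∀ p, 0 < reG a b p) :
    ContMDiff mdl 𝓘(ℝ, ℝ) ∞ (fun p ↦ (reG a b p)⁻¹) := fun p ↦
  (contDiffAt_inv (n := ∞) ℝ (hR p).ne').contMDiffAt.comp p (contMDiff_reG a b p)

lemma mvfderiv_inv_reG (hR : ∀ p, 0 < reG a b p) (p : S1S3) (v : TangentSpace mdl p) :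
    mvfderiv mdl (fun p ↦ (reG a b p)⁻¹) p v
      = -((reG a b p) ^ 2)⁻¹ * ((a.re - b.re) * mvfderiv mdl modSq p v) := by
  rw [mvfderiv_real_comp (hasDerivAt_inv (hR p).ne')
    ((contMDiff_reG a b).mdifferentiable (by simp) p), mvfderiv_reG]

lemma hasExtDeriv_tau (hR : ∀ p, 0 < reG a b p) : HasExtDeriv mdl (tau a b)
    (fun p v w ↦ 2 * (reG a b p)⁻¹ * (yRe a b p v * yIm a b p w - yRe a b p w * yIm a b p v)) := by
  refine ((hasExtDeriv_coform_one.add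
    (hasExtDeriv_coform_zero.smul (contMDiff_imG a b))).smul (contMDiff_inv_reG hR)).congr ?_
  intro p v w
  have h := (hR p).ne'
  rw [mvfderiv_inv_reG hR, mvfderiv_inv_reG hR, mvfderiv_imG, mvfderiv_imG, mvfderiv_modSq,
    mvfderiv_modSq]
  simp only [yRe_apply, yIm_apply, tau_apply, add_apply, smul_apply, smul_eq_mul, slope]
  field_simp
  ring

lemma hasExtDeriv_yRe (hR : ∀ p, 0 < reG a b p) : HasExtDeriv mdl (yRe a b) (fun p v w ↦
    2 * (coform 3 p v * coform 1 p w - coform 3 p w * coform 1 p v)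
    + slope a b * (mvfderiv mdl prodIm p v * coform 0 p w - mvfderiv mdl prodIm p w * coform 0 p v)
    - (a.re - b.re) * (mvfderiv mdl prodIm p v * tau a b p w
      - mvfderiv mdl prodIm p w * tau a b p v)
    - (a.re - b.re) * prodIm p * (2 * (reG a b p)⁻¹
      * (yRe a b p v * yIm a b p w - yRe a b p w * yIm a b p v))) := by
  have hc : ∀ c : ℝ, ContMDiff mdl 𝓘(ℝ, ℝ) ∞ (fun p ↦ c * prodIm p) :=
    fun c ↦ contMDiff_const.mul contMDiff_prodIm
  refine (hasExtDeriv_coform_two.add ((hasExtDeriv_coform_zero.smul (hc _)).add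
    ((hasExtDeriv_tau hR).smul (hc _)))).congr fun p v w ↦ ?_
  simp only [mvfderiv_const_mul_apply _ (contMDiff_prodIm.mdifferentiable (by simp) p)]
  ring

lemma hasExtDeriv_yIm (hR : ∀ p, 0 < reG a b p) : HasExtDeriv mdl (yIm a b) (fun p v w ↦
    2 * (coform 1 p v * coform 2 p w - coform 1 p w * coform 2 p v)
    - slope a b * (mvfderiv mdl prodRe p v * coform 0 p w - mvfderiv mdl prodRe p w * coform 0 p v)
    + (a.re - b.re) * (mvfderiv mdl prodRe p v * tau a b p w
      - mvfderiv mdl prodRe p w * tau a b p v)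
    + (a.re - b.re) * prodRe p * (2 * (reG a b p)⁻¹
      * (yRe a b p v * yIm a b p w - yRe a b p w * yIm a b p v))) := by
  have hc : ∀ c : ℝ, ContMDiff mdl 𝓘(ℝ, ℝ) ∞ (fun p ↦ c * prodRe p) :=
    fun c ↦ contMDiff_const.mul contMDiff_prodRe
  refine (hasExtDeriv_coform_three.add ((hasExtDeriv_coform_zero.smul (hc _)).add
    ((hasExtDeriv_tau hR).smul (hc _)))).congr fun p v w ↦ ?_
  simp only [mvfderiv_const_mul_apply _ (contMDiff_prodRe.mdifferentiable (by simp) p)]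
  ring

variable (a b) in
/-- `(Re G)^{-1/2}`. -/
noncomputable def invSqrtG (p : S1S3) : ℝ := (√(reG a b p))⁻¹

lemma contMDiff_sqrt_reG (hR : ∀ p, 0 < reG a b p) :
    ContMDiff mdl 𝓘(ℝ, ℝ) ∞ (fun p ↦ √(reG a b p)) := fun p ↦
  (Real.contDiffAt_sqrt (n := ∞) (hR p).ne').contMDiffAt.comp p (contMDiff_reG a b p)

lemma contMDiff_invSqrtG (hR : ∀ p, 0 < reG a b p) :
    ContMDiff mdl 𝓘(ℝ, ℝ) ∞ (invSqrtG a b) := fun p ↦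
  (contDiffAt_inv (n := ∞) ℝ (Real.sqrt_pos.2 (hR p)).ne').contMDiffAt.comp p
    (contMDiff_sqrt_reG hR p)

lemma invSqrtG_sq (hR : ∀ p, 0 < reG a b p) (p : S1S3) :
    invSqrtG a b p ^ 2 = (reG a b p)⁻¹ := by
  rw [invSqrtG, inv_pow, Real.sq_sqrt (hR p).le]

lemma mvfderiv_invSqrtG_eq_zero (hR : ∀ p, 0 < reG a b p) {p : S1S3} {v : TangentSpace mdl p}
    (hv : mvfderiv mdl modSq p v = 0) : mvfderiv mdl (invSqrtG a b) p v = 0 := by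
  have h1 := (Real.hasDerivAt_sqrt (hR p).ne').inv (Real.sqrt_pos.2 (hR p)).ne'
  have h := mvfderiv_real_comp h1 ((contMDiff_reG a b).mdifferentiable (by simp) p) v
  rw [mvfderiv_reG, hv, mul_zero, mul_zero] at h
  exact h

variable (a b) in
/-- A global coframe in which `g^h_{α,β}` is diagonal. -/
noncomputable def hopfCoframe : Fin 4 → Π p : S1S3, TangentSpace mdl p →L[ℝ] ℝ :=
  ![coform 0, tau a b, fun p ↦ invSqrtG a b p • yRe a b p, fun p ↦ invSqrtG a b p • yIm a b p]

variable (a b) in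
/-- The exterior derivatives of `hopfCoframe`. -/
noncomputable def hopfCoframeDeriv :
    Fin 4 → Π p : S1S3, TangentSpace mdl p → TangentSpace mdl p → ℝ :=
  ![fun _ _ _ ↦ 0,
    fun p v w ↦ 2 * (reG a b p)⁻¹ * (yRe a b p v * yIm a b p w - yRe a b p w * yIm a b p v),
    fun p v w ↦ invSqrtG a b p * (
      2 * (coform 3 p v * coform 1 p w - coform 3 p w * coform 1 p v)
      + slope a b * (mvfderiv mdl prodIm p v * coform 0 p w
        - mvfderiv mdl prodIm p w * coform 0 p v)
      - (a.re - b.re) * (mvfderiv mdl prodIm p v * tau a b p w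
        - mvfderiv mdl prodIm p w * tau a b p v)
      - (a.re - b.re) * prodIm p * (2 * (reG a b p)⁻¹
        * (yRe a b p v * yIm a b p w - yRe a b p w * yIm a b p v)))
      + (mvfderiv mdl (invSqrtG a b) p v * yRe a b p w
        - mvfderiv mdl (invSqrtG a b) p w * yRe a b p v),
    fun p v w ↦ invSqrtG a b p * (
      2 * (coform 1 p v * coform 2 p w - coform 1 p w * coform 2 p v)
      - slope a b * (mvfderiv mdl prodRe p v * coform 0 p w
        - mvfderiv mdl prodRe p w * coform 0 p v)
      + (a.re - b.re) * (mvfderiv mdl prodRe p v * tau a b p w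
        - mvfderiv mdl prodRe p w * tau a b p v)
      + (a.re - b.re) * prodRe p * (2 * (reG a b p)⁻¹
        * (yRe a b p v * yIm a b p w - yRe a b p w * yIm a b p v)))
      + (mvfderiv mdl (invSqrtG a b) p v * yIm a b p w
        - mvfderiv mdl (invSqrtG a b) p w * yIm a b p v)]

lemma hasExtDeriv_hopfCoframe (hR : ∀ p, 0 < reG a b p) (i : Fin 4) :
    HasExtDeriv mdl (hopfCoframe a b i) (hopfCoframeDeriv a b i) := by
  fin_cases i
  · exact hasExtDeriv_coform_zero
  · exact hasExtDeriv_tau hR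
  · exact (hasExtDeriv_yRe hR).smul (contMDiff_invSqrtG hR)
  · exact (hasExtDeriv_yIm hR).smul (contMDiff_invSqrtG hR)

lemma coform_sum_frame (p : S1S3) (c : Fin 4 → ℝ) (j : Fin 4) :
    coform j p (∑ i, c i • frame p i) = c j := by
  rw [coform_apply, coframe_sum_smul]

variable (a b) in
/-- The components in `e₁, e₂, e₃, e₄` of the frame dual to `hopfCoframe`. -/
noncomputable def hopfFrameCoeff (p : S1S3) : Fin 4 → Fin 4 → ℝ :=
  ![![1, -1 * imG a b p, -slope a b * prodIm p, slope a b * prodRe p],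
    ![0, reG a b p, (a.re - b.re) * prodIm p, -(a.re - b.re) * prodRe p],
    ![0, 0, √(reG a b p), 0],
    ![0, 0, 0, √(reG a b p)]]

variable (a b) in
/-- The frame dual to `hopfCoframe`. -/
noncomputable def hopfFrame (i : Fin 4) (p : S1S3) : TangentSpace mdl p :=
  ∑ j, hopfFrameCoeff a b p i j • frame p j

lemma isSmoothField_sum_frame {c : S1S3 → Fin 4 → ℝ}
    (hc : ∀ j, ContMDiff mdl 𝓘(ℝ, ℝ) ∞ (fun p ↦ c p j)) :
    IsSmoothField mdl (fun p ↦ ∑ j, c p j • frame p j) := by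
  have hΦ : ContMDiff mdl 𝓘(ℝ, ℂ × R4) ∞ (fun q : S1S3 ↦ ((q.1 : ℂ), (q.2 : R4))) :=
    contMDiff_circle.prodMk_space contMDiff_sphere
  have hd : ∀ p v, mvfderiv mdl (fun q : S1S3 ↦ ((q.1 : ℂ), (q.2 : R4))) p v
      = (dCircle p v, dSphere p v) := by
    intro p v
    have h1 := mvfderiv_clm_comp (ContinuousLinearMap.fst ℝ ℂ R4)
      (hΦ.mdifferentiable (by simp) p) v
    have h2 := mvfderiv_clm_comp (ContinuousLinearMap.snd ℝ ℂ R4)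
      (hΦ.mdifferentiable (by simp) p) v
    exact Prod.ext h1.symm h2.symm
  refine isSmoothField_of_immersion hΦ (fun p v w hvw ↦ ?_) ?_
  · rw [hd, hd, Prod.mk.injEq] at hvw
    refine ext_coframe fun i ↦ ?_
    simp only [coframe, hvw.1, hvw.2]
  · simp only [hd, dCircle_eq, dSphere_eq, coframe_sum_smul]
    have hq : ∀ u : R4 → R4, ContDiff ℝ ∞ u →
        ContMDiff mdl 𝓘(ℝ, R4) ∞ (fun q : S1S3 ↦ u q.2) :=
      fun u hu ↦ hu.contMDiff.comp contMDiff_sphere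
    have hpi : ∀ f : R4 → Fin 4 → ℝ, (∀ i, ContDiff ℝ ∞ (fun x ↦ f x i)) →
        ContDiff ℝ ∞ (fun x ↦ WithLp.toLp 2 (f x)) :=
      fun f hf ↦ (EuclideanSpace.equiv (Fin 4) ℝ).symm.contDiff.comp (contDiff_pi.2 hf)
    have hI : ContDiff ℝ ∞ quatI :=
      hpi (fun x ↦ ![-x 1, x 0, -x 3, x 2]) fun i ↦ by fin_cases i <;> simp <;> fun_prop
    have hJ : ContDiff ℝ ∞ quatJ :=
      hpi (fun x ↦ ![-x 2, x 3, x 0, -x 1]) fun i ↦ by fin_cases i <;> simp <;> fun_prop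
    have hK : ContDiff ℝ ∞ quatK :=
      hpi (fun x ↦ ![-x 3, -x 2, x 1, x 0]) fun i ↦ by fin_cases i <;> simp <;> fun_prop
    refine ContMDiff.prodMk_space ?_ ((((hc 1).smul (hq _ hI)).add ((hc 2).smul (hq _ hJ))).add
      ((hc 3).smul (hq _ hK)))
    have h0 := (hc 0).smul ((ContinuousLinearMap.mul ℝ ℂ Complex.I).contMDiff.comp contMDiff_circle)
    simpa only [Complex.real_smul] using! h0

lemma isSmoothField_hopfFrame (hR : ∀ p, 0 < reG a b p) (i : Fin 4) :
    IsSmoothField mdl (hopfFrame a b i) := by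
  refine isSmoothField_sum_frame fun j ↦ ?_
  have h0 : ∀ c : ℝ, ContMDiff mdl 𝓘(ℝ, ℝ) ∞ (fun _ : S1S3 ↦ c) := fun c ↦ contMDiff_const
  have h1 : ∀ c : ℝ, ContMDiff mdl 𝓘(ℝ, ℝ) ∞ (fun p ↦ c * prodRe p) :=
    fun c ↦ contMDiff_const.mul contMDiff_prodRe
  have h2 : ∀ c : ℝ, ContMDiff mdl 𝓘(ℝ, ℝ) ∞ (fun p ↦ c * prodIm p) :=
    fun c ↦ contMDiff_const.mul contMDiff_prodIm
  have h3 : ContMDiff mdl 𝓘(ℝ, ℝ) ∞ (fun p ↦ -1 * imG a b p) :=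
    contMDiff_const.mul (contMDiff_imG a b)
  fin_cases i <;> fin_cases j
  · exact h0 1
  · exact h3
  · exact h2 _
  · exact h1 _
  · exact h0 0
  · exact contMDiff_reG a b
  · exact h2 _
  · exact h1 _
  · exact h0 0
  · exact h0 0
  · exact contMDiff_sqrt_reG hR
  · exact h0 0
  · exact h0 0
  · exact h0 0
  · exact h0 0
  · exact contMDiff_sqrt_reG hR

lemma coform_hopfFrame (i j : Fin 4) (p : S1S3) :
    coform j p (hopfFrame a b i p) = hopfFrameCoeff a b p i j := coform_sum_frame p _ j

lemma tau_hopfFrame (hR : ∀ p, 0 < reG a b p) (i : Fin 4) (p : S1S3) :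
    tau a b p (hopfFrame a b i p) = (![0, 1, 0, 0] : Fin 4 → ℝ) i := by
  have h1 := inv_mul_cancel₀ (hR p).ne'
  rw [tau_apply, coform_hopfFrame, coform_hopfFrame]
  fin_cases i
  · change _ * (-1 * imG a b p + _ * 1) = (0 : ℝ)
    ring
  · change _ * (reG a b p + _ * 0) = (1 : ℝ)
    linear_combination h1
  · change _ * (0 + _ * 0) = (0 : ℝ)
    ring
  · change _ * (0 + _ * 0) = (0 : ℝ)
    ring

lemma yRe_hopfFrame (hR : ∀ p, 0 < reG a b p) (i : Fin 4) (p : S1S3) :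
    yRe a b p (hopfFrame a b i p) = (![0, 0, √(reG a b p), 0] : Fin 4 → ℝ) i := by
  rw [yRe_apply, coform_hopfFrame, coform_hopfFrame, tau_hopfFrame hR]
  fin_cases i
  · change -slope a b * prodIm p + (_ * 1 + _ * 0) = (0 : ℝ)
    ring
  · change (a.re - b.re) * prodIm p + (_ * 0 + _ * 1) = (0 : ℝ)
    ring
  · change √(reG a b p) + (_ * 0 + _ * 0) = √(reG a b p)
    ring
  · change 0 + (_ * 0 + _ * 0) = (0 : ℝ)
    ring

lemma yIm_hopfFrame (hR : ∀ p, 0 < reG a b p) (i : Fin 4) (p : S1S3) :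
    yIm a b p (hopfFrame a b i p) = (![0, 0, 0, √(reG a b p)] : Fin 4 → ℝ) i := by
  rw [yIm_apply, coform_hopfFrame, coform_hopfFrame, tau_hopfFrame hR]
  fin_cases i
  · change slope a b * prodRe p + (_ * 1 + _ * 0) = (0 : ℝ)
    ring
  · change -(a.re - b.re) * prodRe p + (_ * 0 + _ * 1) = (0 : ℝ)
    ring
  · change 0 + (_ * 0 + _ * 0) = (0 : ℝ)
    ring
  · change √(reG a b p) + (_ * 0 + _ * 0) = √(reG a b p)
    ring

lemma invSqrtG_mul_sqrt (hR : ∀ p, 0 < reG a b p) (p : S1S3) :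
    invSqrtG a b p * √(reG a b p) = 1 := inv_mul_cancel₀ (Real.sqrt_pos.2 (hR p)).ne'

lemma hopfCoframe_hopfFrame (hR : ∀ p, 0 < reG a b p) (i j : Fin 4) (p : S1S3) :
    hopfCoframe a b i p (hopfFrame a b j p) = if i = j then 1 else 0 := by
  have h2 := invSqrtG_mul_sqrt hR p
  fin_cases i
  · change coform 0 p (hopfFrame a b j p) = if 0 = j then 1 else 0
    rw [coform_hopfFrame]
    fin_cases j <;> simp [hopfFrameCoeff]
  · change tau a b p (hopfFrame a b j p) = if 1 = j then 1 else 0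
    rw [tau_hopfFrame hR]
    fin_cases j <;> simp
  · change invSqrtG a b p * yRe a b p (hopfFrame a b j p) = if 2 = j then 1 else 0
    rw [yRe_hopfFrame hR]
    fin_cases j <;> simp [h2]
  · change invSqrtG a b p * yIm a b p (hopfFrame a b j p) = if 3 = j then 1 else 0
    rw [yIm_hopfFrame hR]
    fin_cases j <;> simp [h2]

lemma isGlobalCoframe_hopf (hR : ∀ p, 0 < reG a b p) :
    IsGlobalCoframe mdl (hopfCoframe a b) (hopfCoframeDeriv a b) (hopfFrame a b) where
  hasExtDeriv := hasExtDeriv_hopfCoframe hR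
  isSmoothField := isSmoothField_hopfFrame hR
  apply_frame := hopfCoframe_hopfFrame hR
  sum_smul p v := by
    have h1 : (reG a b p)⁻¹ * reG a b p = 1 := inv_mul_cancel₀ (hR p).ne'
    have h2 := invSqrtG_mul_sqrt hR p
    have h3 : (∑ i, hopfCoframe a b i p v • hopfFrame a b i p)
        = ∑ j, (∑ i, hopfCoframe a b i p v * hopfFrameCoeff a b p i j) • frame p j := by
      simp only [hopfFrame, Fin.sum_univ_four]
      module
    rw [h3]
    refine ext_coframe fun j ↦ ?_
    rw [coframe_sum_smul, ← coform_apply, Fin.sum_univ_four]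
    change coform 0 p v * _ + tau a b p v * _ + (invSqrtG a b p * yRe a b p v) * _
      + (invSqrtG a b p * yIm a b p v) * _ = _
    fin_cases j
    · change _ * 1 + _ * 0 + _ * 0 + _ * 0 = coform 0 p v
      ring
    · change _ * (-1 * imG a b p) + _ * reG a b p + _ * 0 + _ * 0 = coform 1 p v
      rw [tau_apply]
      linear_combination (coform 1 p v + imG a b p * coform 0 p v) * h1
    · change _ * (-slope a b * prodIm p) + _ * ((a.re - b.re) * prodIm p)
        + _ * √(reG a b p) + _ * 0 = coform 2 p v
      have h4 := yRe_apply (a := a) (b := b) p v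
      linear_combination yRe a b p v * h2 + h4
    · change _ * (slope a b * prodRe p) + _ * (-(a.re - b.re) * prodRe p)
        + _ * 0 + _ * √(reG a b p) = coform 3 p v
      have h4 := yIm_apply (a := a) (b := b) p v
      linear_combination yIm a b p v * h2 + h4

end HopfMetric

namespace HopfMetric

open LCK Bundle

variable {a b : ℂ}

lemma a_sub_b_eq (a b : ℂ) :
    a - b = ((a.re - b.re : ℝ) : ℂ) + (2 * Real.pi * slope a b : ℝ) * Complex.I := by
  have := Real.pi_ne_zero
  have h : 2 * Real.pi * slope a b = a.im - b.im := by
    simp only [slope]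
    field_simp
  rw [h]
  apply Complex.ext <;> simp

lemma G_eq (a b : ℂ) (p : S1S3) :
    G a b p = reG a b p + (2 * Real.pi * imG a b p : ℝ) * Complex.I := by
  rw [← G_re, ← G_im]
  exact (Complex.re_add_im _).symm

lemma complexCoord_zero (hR : ∀ p, 0 < reG a b p) (p : S1S3) (v : TangentSpace mdl p) :
    complexCoord a b p v 0 = (reG a b p * tau a b p v : ℝ)
      - (reG a b p / (2 * Real.pi) * coform 0 p v : ℝ) * Complex.I := by
  have hπ : (Real.pi : ℂ) ≠ 0 := by exact_mod_cast Real.pi_ne_zero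
  have h1 : reG a b p * tau a b p v = coform 1 p v + imG a b p * coform 0 p v := by
    rw [tau_apply, ← mul_assoc, mul_inv_cancel₀ (hR p).ne', one_mul]
  rw [h1]
  simp only [complexCoord, G_eq, Matrix.cons_val_zero, coform_apply]
  push_cast
  field_simp
  linear_combination (-2 * Real.pi * imG a b p * coframe p v 0) * Complex.I_sq

lemma yRe_add_yIm (hR : ∀ p, 0 < reG a b p) (p : S1S3) (v : TangentSpace mdl p) :
    (yRe a b p v + yIm a b p v * Complex.I : ℂ) = complexCoord a b p v 1
      + Complex.I * (xi1 p * xi2 p) * ((a.re - b.re : ℝ) / reG a b p : ℝ)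
        * complexCoord a b p v 0 := by
  have hπ : (Real.pi : ℂ) ≠ 0 := by exact_mod_cast Real.pi_ne_zero
  have h1 : (reG a b p : ℂ) ≠ 0 := by exact_mod_cast (hR p).ne'
  rw [complexCoord_zero hR]
  simp only [complexCoord, Matrix.cons_val_one, xi1_mul_xi2, yRe_apply, yIm_apply,
    ← coform_apply]
  rw [a_sub_b_eq a b]
  push_cast
  field_simp
  ring_nf
  simp only [Complex.I_sq, Complex.I_pow_three]
  ring

variable (h : ℝ → ℝ)

/-- The function `h` on `S¹ × S³`. -/
noncomputable def circleFun (p : S1S3) : ℝ := h (Complex.arg p.1)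

lemma metric_eq (hR : ∀ p, 0 < reG a b p) (p : S1S3) (v w : TangentSpace mdl p) :
    metric a b h p v w = circleFun h p / (4 * Real.pi) * (coform 0 p v * coform 0 p w)
      + Real.pi * circleFun h p * (tau a b p v * tau a b p w)
      + (reG a b p)⁻¹ * (yRe a b p v * yRe a b p w + yIm a b p v * yIm a b p w) := by
  have hπ := Real.pi_ne_zero
  have h1 := (hR p).ne'
  have hu : ‖xi1 p‖ ^ 2 * ‖xi2 p‖ ^ 2 = prodRe p ^ 2 + prodIm p ^ 2 := by
    rw [norm_xi1_sq, norm_xi2_sq, prodRe_sq_add_prodIm_sq]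
  have hx : ∀ v, complexCoord a b p v 1 = (yRe a b p v + yIm a b p v * Complex.I : ℂ)
      - Complex.I * (xi1 p * xi2 p) * ((a.re - b.re : ℝ) / reG a b p : ℝ)
        * complexCoord a b p v 0 := fun v ↦ by rw [yRe_add_yIm hR]; ring
  have he : ∀ z : ℂ, z * ((a.re - b.re : ℝ) : ℂ) / (reG a b p : ℂ) ^ 2
      = z * (((a.re - b.re) / reG a b p ^ 2 : ℝ) : ℂ) := fun z ↦ by push_cast; ring
  simp only [metric, metricMatrix, Fin.sum_univ_two]
  simp only [Matrix.of_apply, Matrix.cons_val_zero, Matrix.cons_val_one, Matrix.cons_val_fin_one,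
    hu, hx, complexCoord_zero hR, xi1_mul_xi2, G_re, circleFun, he]
  simp [-Complex.ofReal_mul, -Complex.ofReal_sub, -Complex.ofReal_div, -Complex.ofReal_add,
    -Complex.ofReal_inv, -Complex.ofReal_pow]
  field_simp
  ring

lemma coform_J (p : S1S3) (v : TangentSpace mdl p) (j : Fin 4) :
    coform j p (J a b p v) = ∑ i, coform i p v * JMatrix a b p i j := by
  have hJ : J a b p v = ∑ j, (∑ i, coframe p v i * JMatrix a b p i j) • frame p j := by
    simp only [J, Fin.sum_univ_four]
    module
  rw [hJ, coform_sum_frame]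
  simp only [coform_apply]

lemma coform_zero_J (hR : ∀ p, 0 < reG a b p) (p : S1S3) (v : TangentSpace mdl p) :
    coform 0 p (J a b p v) = -(2 * Real.pi) * tau a b p v := by
  have h1 := (hR p).ne'
  rw [coform_J, tau_apply, Fin.sum_univ_four]
  simp [JMatrix, G_re, G_im]
  field_simp
  ring

lemma tau_J (hR : ∀ p, 0 < reG a b p) (p : S1S3) (v : TangentSpace mdl p) :
    tau a b p (J a b p v) = (2 * Real.pi)⁻¹ * coform 0 p v := by
  have h1 := (hR p).ne'
  have hπ := Real.pi_ne_zero
  have hn : ‖G a b p‖ ^ 2 = reG a b p ^ 2 + (2 * Real.pi * imG a b p) ^ 2 := by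
    rw [← Complex.normSq_eq_norm_sq, Complex.normSq_apply, G_re, G_im]
    ring
  rw [tau_apply, coform_zero_J hR, coform_J, tau_apply, Fin.sum_univ_four]
  simp [JMatrix, G_re, G_im, hn]
  field_simp
  ring

lemma coform_two_J (hR : ∀ p, 0 < reG a b p) (p : S1S3) (v : TangentSpace mdl p) :
    coform 2 p (J a b p v) = -coform 3 p v
      - (prodRe p * (a.re - b.re) - prodIm p * (2 * Real.pi * slope a b)) * tau a b p v
      + (prodIm p * (a.re - b.re) + prodRe p * (2 * Real.pi * slope a b)) / (2 * Real.pi)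
        * coform 0 p v := by
  have h1 := (hR p).ne'
  have hπ := Real.pi_ne_zero
  rw [coform_J, tau_apply, Fin.sum_univ_four]
  simp only [JMatrix, G_re, G_im, xi1_mul_xi2, a_sub_b_eq a b]
  simp [G_re, G_im]
  field_simp
  ring

lemma coform_three_J (hR : ∀ p, 0 < reG a b p) (p : S1S3) (v : TangentSpace mdl p) :
    coform 3 p (J a b p v) = coform 2 p v
      - (prodIm p * (a.re - b.re) + prodRe p * (2 * Real.pi * slope a b)) * tau a b p v
      - (prodRe p * (a.re - b.re) - prodIm p * (2 * Real.pi * slope a b)) / (2 * Real.pi)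
        * coform 0 p v := by
  have h1 := (hR p).ne'
  have hπ := Real.pi_ne_zero
  rw [coform_J, tau_apply, Fin.sum_univ_four]
  simp only [JMatrix, G_re, G_im, xi1_mul_xi2, a_sub_b_eq a b]
  simp [G_re, G_im]
  field_simp
  ring

lemma yRe_J (hR : ∀ p, 0 < reG a b p) (p : S1S3) (v : TangentSpace mdl p) :
    yRe a b p (J a b p v) = -yIm a b p v := by
  have hπ := Real.pi_ne_zero
  rw [yRe_apply, yIm_apply, coform_zero_J hR, tau_J hR, coform_two_J hR]
  field_simp
  ring

lemma yIm_J (hR : ∀ p, 0 < reG a b p) (p : S1S3) (v : TangentSpace mdl p) :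
    yIm a b p (J a b p v) = yRe a b p v := by
  have hπ := Real.pi_ne_zero
  rw [yRe_apply, yIm_apply, coform_zero_J hR, tau_J hR, coform_three_J hR]
  field_simp
  ring

lemma metric_J_J (hR : ∀ p, 0 < reG a b p) (p : S1S3) (v w : TangentSpace mdl p) :
    metric a b h p (J a b p v) (J a b p w) = metric a b h p v w := by
  have hπ := Real.pi_ne_zero
  rw [metric_eq h hR, metric_eq h hR]
  simp only [coform_zero_J hR, tau_J hR, yRe_J hR, yIm_J hR]
  field_simp
  ring

lemma metric_J_left (hR : ∀ p, 0 < reG a b p) (p : S1S3) (v w : TangentSpace mdl p) :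
    metric a b h p (J a b p v) w =
      (reG a b p)⁻¹ * (yRe a b p v * yIm a b p w - yRe a b p w * yIm a b p v)
        + circleFun h p / 2 * (coform 0 p v * tau a b p w - coform 0 p w * tau a b p v) := by
  have hπ := Real.pi_ne_zero
  rw [metric_eq h hR]
  simp only [coform_zero_J hR, tau_J hR, yRe_J hR, yIm_J hR]
  field_simp
  ring

/-- The diagonal entries of `g^h_{α,β}` in `hopfCoframe`. -/
noncomputable def metricWeight : Fin 4 → S1S3 → ℝ :=
  ![fun p ↦ circleFun h p / (4 * Real.pi), fun p ↦ Real.pi * circleFun h p, fun _ ↦ 1, fun _ ↦ 1]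

lemma metric_eq_sum (hR : ∀ p, 0 < reG a b p) : metric a b h = fun p v w ↦
    ∑ i, metricWeight h i p * (hopfCoframe a b i p v * hopfCoframe a b i p w) := by
  ext p v w
  rw [metric_eq h hR, Fin.sum_univ_four, ← invSqrtG_sq hR]
  change _ = _ * (coform 0 p v * coform 0 p w) + _ * (tau a b p v * tau a b p w)
    + 1 * ((invSqrtG a b p * yRe a b p v) * (invSqrtG a b p * yRe a b p w))
    + 1 * ((invSqrtG a b p * yIm a b p v) * (invSqrtG a b p * yIm a b p w))
  simp only [metricWeight, Matrix.cons_val_zero, Matrix.cons_val_one]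
  ring

end HopfMetric

namespace HopfMetric

open LCK Bundle

lemma mvfderiv_fderiv_comp {F F' : Type*} [NormedAddCommGroup F] [NormedSpace ℝ F]
    [NormedAddCommGroup F'] [NormedSpace ℝ F'] {φ : F → F'} {φ' : F →L[ℝ] F'} {f : S1S3 → F}
    {p : S1S3} (hφ : HasFDerivAt φ φ' (f p)) (hf : MDifferentiableAt mdl 𝓘(ℝ, F) f p)
    (v : TangentSpace mdl p) :
    mvfderiv mdl (fun q ↦ φ (f q)) p v = φ' (mvfderiv mdl f p v) := by
  have h := hφ.hasMFDerivAt.comp p hf.hasMFDerivAt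
  exact congrArg (fun K ↦ K v) h.mfderiv

/-- The branch of the argument of the `S¹` coordinate which is continuous away from `-z`. -/
noncomputable def localArg (z : Circle) (q : S1S3) : ℝ :=
  (Complex.log ((z⁻¹ : Circle) * (q.1 : ℂ))).im + Complex.arg z

/-- The open set of the points whose `S¹` coordinate is not `-z`. -/
def argDomain (z : Circle) : Set S1S3 :=
  {q | ((z⁻¹ : Circle) * (q.1 : ℂ)) ∈ Complex.slitPlane}

lemma isOpen_argDomain (z : Circle) : IsOpen (argDomain z) :=
  Complex.isOpen_slitPlane.preimage
    (continuous_const.mul (contMDiff_circle.continuous))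

lemma mem_argDomain (p : S1S3) : p ∈ argDomain p.1 := by
  simp [argDomain]

lemma localArg_self (p : S1S3) : localArg p.1 p = Complex.arg p.1 := by
  simp [localArg]

lemma contMDiffAt_localArg {z : Circle} {q : S1S3} (hq : q ∈ argDomain z) :
    ContMDiffAt mdl 𝓘(ℝ, ℝ) ∞ (localArg z) q := by
  have h1 : ContDiffAt ℝ ∞
      (fun w : ℂ ↦ (Complex.log ((z⁻¹ : Circle) * w)).im + Complex.arg z) (q.1 : ℂ) := by
    have h2 : ContDiffAt ℝ ∞ (fun w : ℂ ↦ Complex.log ((z⁻¹ : Circle) * w)) (q.1 : ℂ) :=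
      ((Complex.contDiffAt_log hq).restrict_scalars ℝ).comp (q.1 : ℂ)
        (contDiffAt_const.mul contDiffAt_id)
    exact (Complex.imCLM.contDiff.contDiffAt.comp (q.1 : ℂ) h2).add contDiffAt_const
  exact h1.contMDiffAt.comp q (contMDiff_circle q)

lemma mvfderiv_localArg {z : Circle} {q : S1S3} (hq : q ∈ argDomain z) (v : TangentSpace mdl q) :
    mvfderiv mdl (localArg z) q v = coform 0 q v := by
  have h2 : HasDerivAt (fun w : ℂ ↦ Complex.log ((z⁻¹ : Circle) * w))
      (((z⁻¹ : Circle) * (q.1 : ℂ))⁻¹ * ((z⁻¹ : Circle) * 1)) (q.1 : ℂ) :=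
    (Complex.hasDerivAt_log hq).comp (q.1 : ℂ) ((hasDerivAt_id _).const_mul _)
  have h3 := (Complex.imCLM.hasFDerivAt.comp (q.1 : ℂ)
    (h2.hasFDerivAt.restrictScalars ℝ)).add_const (Complex.arg z)
  have h4 := mvfderiv_fderiv_comp h3 (mdifferentiableAt_circle q) v
  refine h4.trans ?_
  change (dCircle q v * (((z⁻¹ : Circle) * (q.1 : ℂ))⁻¹ * ((z⁻¹ : Circle) * 1))).im = _
  have hz : ((z⁻¹ : Circle) : ℂ) ≠ 0 := Circle.coe_ne_zero _
  have hq1 : (q.1 : ℂ) ≠ 0 := Circle.coe_ne_zero _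
  have h5 : dCircle q v * (((z⁻¹ : Circle) * (q.1 : ℂ))⁻¹ * ((z⁻¹ : Circle) * 1))
      = coframe q v 0 * Complex.I := by
    rw [dCircle_eq]
    field_simp
  rw [h5, coform_apply]
  simp

lemma exp_localArg (z : Circle) (q : S1S3) :
    Complex.exp (localArg z q * Complex.I) = q.1 := by
  have h1 := Complex.norm_mul_exp_arg_mul_I ((z⁻¹ : Circle) * (q.1 : ℂ))
  have h2 := Complex.norm_mul_exp_arg_mul_I (z : ℂ)
  have h3 : ‖((z⁻¹ : Circle) * (q.1 : ℂ) : ℂ)‖ = 1 := by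
    rw [norm_mul, Circle.norm_coe, Circle.norm_coe, one_mul]
  rw [h3] at h1
  rw [Circle.norm_coe] at h2
  simp only [Complex.ofReal_one, one_mul] at h1 h2
  rw [localArg, Complex.log_im]
  rw [Complex.ofReal_add, add_mul, Complex.exp_add, h1, h2]
  have hz : (z : ℂ) ≠ 0 := Circle.coe_ne_zero _
  rw [Circle.coe_inv]
  field_simp

variable {h : ℝ → ℝ}

lemma circleFun_eq_localArg (h_periodic : Function.Periodic h (2 * Real.pi)) (z : Circle)
    (q : S1S3) : circleFun h q = h (localArg z q) := by
  have h1 := Complex.norm_mul_exp_arg_mul_I (q.1 : ℂ)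
  rw [Circle.norm_coe, Complex.ofReal_one, one_mul, ← exp_localArg z q,
    Complex.exp_eq_exp_iff_exists_int] at h1
  obtain ⟨n, hn⟩ := h1
  have h2 : Complex.arg q.1 = localArg z q + n * (2 * Real.pi) := by
    have h3 : (Complex.arg q.1 : ℂ) = localArg z q + n * (2 * Real.pi) := by
      refine mul_right_cancel₀ Complex.I_ne_zero ?_
      rw [exp_localArg] at hn
      rw [hn]
      ring
    exact_mod_cast h3
  rw [circleFun, h2, h_periodic.int_mul n]

lemma contMDiff_circleFun (h_smooth : ContDiff ℝ ∞ h)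
    (h_periodic : Function.Periodic h (2 * Real.pi)) :
    ContMDiff mdl 𝓘(ℝ, ℝ) ∞ (circleFun h) := by
  have h0 : ∀ z, circleFun h = h ∘ localArg z := fun z ↦ by
    ext q
    exact circleFun_eq_localArg h_periodic z q
  intro p
  rw [h0 p.1]
  exact h_smooth.contMDiff.contMDiffAt.comp p (contMDiffAt_localArg (mem_argDomain p))

lemma mvfderiv_circleFun (h_smooth : ContDiff ℝ ∞ h)
    (h_periodic : Function.Periodic h (2 * Real.pi)) (p : S1S3) (v : TangentSpace mdl p) :
    mvfderiv mdl (circleFun h) p v = deriv h (Complex.arg p.1) * coform 0 p v := by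
  have h0 : circleFun h = fun q ↦ h (localArg p.1 q) := by
    ext q
    exact circleFun_eq_localArg h_periodic p.1 q
  rw [h0, mvfderiv_real_comp (h_smooth.differentiable (by simp) _).hasDerivAt
    ((contMDiffAt_localArg (mem_argDomain p)).mdifferentiableAt (by simp)),
    mvfderiv_localArg (mem_argDomain p), localArg_self]

lemma hasExtDeriv_circleFun_smul (h_smooth : ContDiff ℝ ∞ h)
    (h_periodic : Function.Periodic h (2 * Real.pi)) :
    HasExtDeriv mdl (fun p ↦ circleFun h p • coform 0 p) (fun _ _ _ ↦ 0) := by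
  refine (hasExtDeriv_coform_zero.smul
    (contMDiff_circleFun h_smooth h_periodic)).congr fun p v w ↦ ?_
  rw [mvfderiv_circleFun h_smooth h_periodic, mvfderiv_circleFun h_smooth h_periodic]
  ring

variable {a b : ℂ}

lemma extDerivTwo_exp_mul_fundamentalForm (hR : ∀ p, 0 < reG a b p) (h_smooth : ContDiff ℝ ∞ h)
    (h_periodic : Function.Periodic h (2 * Real.pi)) {f : S1S3 → ℝ} {p : S1S3}
    (hf : MDifferentiableAt mdl 𝓘(ℝ, ℝ) f p) {X Y Z : Π p : S1S3, TangentSpace mdl p}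
    (hX : IsSmoothField mdl X) (hY : IsSmoothField mdl Y) (hZ : IsSmoothField mdl Z) :
    extDerivTwo mdl (fundamentalForm mdl (J a b)
        (fun x v w ↦ Real.exp (-f x) * metric a b h x v w)) X Y Z p =
      -(Real.exp (-f p) * ((mvfderiv mdl f p (X p) + circleFun h p * coform 0 p (X p))
          * metric a b h p (J a b p (Y p)) (Z p)
        + (mvfderiv mdl f p (Y p) + circleFun h p * coform 0 p (Y p))
          * metric a b h p (J a b p (Z p)) (X p)
        + (mvfderiv mdl f p (Z p) + circleFun h p * coform 0 p (Z p))
          * metric a b h p (J a b p (X p)) (Y p))) := by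
  have hσ := (hasExtDeriv_tau hR).smul
    (contMDiff_const (c := (1 / 2 : ℝ)) : ContMDiff mdl 𝓘(ℝ, ℝ) ∞ _)
  refine extDerivTwo_exp_mul (Ω := fun x v w ↦ metric a b h x (J a b x v) w)
    (hasExtDeriv_circleFun_smul h_smooth h_periodic) hσ (fun x v w ↦ ?_) hf hX hY hZ
  rw [metric_J_left h hR, mvfderiv_const]
  simp only [zero_apply, smul_apply, smul_eq_mul]
  ring

/-- The primitive of `-h`, as a function of the local argument. -/
noncomputable def conformalFactor (h : ℝ → ℝ) (z : Circle) (q : S1S3) : ℝ :=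
  -1 * ∫ t in (0 : ℝ)..localArg z q, h t

lemma hasDerivAt_primitive (h_smooth : ContDiff ℝ ∞ h) (t : ℝ) :
    HasDerivAt (fun t ↦ ∫ s in (0 : ℝ)..t, h s) (h t) t :=
  intervalIntegral.integral_hasDerivAt_right (h_smooth.continuous.intervalIntegrable _ _)
    (h_smooth.continuous.stronglyMeasurableAtFilter _ _) h_smooth.continuous.continuousAt

lemma contDiff_primitive (h_smooth : ContDiff ℝ ∞ h) :
    ContDiff ℝ ∞ (fun t ↦ ∫ s in (0 : ℝ)..t, h s) := by
  rw [contDiff_infty_iff_deriv]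
  refine ⟨fun t ↦ (hasDerivAt_primitive h_smooth t).differentiableAt, ?_⟩
  have : deriv (fun t ↦ ∫ s in (0 : ℝ)..t, h s) = h :=
    funext fun t ↦ (hasDerivAt_primitive h_smooth t).deriv
  rwa [this]

lemma contMDiffAt_conformalFactor (h_smooth : ContDiff ℝ ∞ h) {z : Circle} {q : S1S3}
    (hq : q ∈ argDomain z) : ContMDiffAt mdl 𝓘(ℝ, ℝ) ∞ (conformalFactor h z) q :=
  (contMDiffAt_const (c := (-1 : ℝ))).mul
    ((contDiff_primitive h_smooth).contMDiff.contMDiffAt.comp q (contMDiffAt_localArg hq))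

lemma mvfderiv_conformalFactor (h_smooth : ContDiff ℝ ∞ h)
    (h_periodic : Function.Periodic h (2 * Real.pi)) {z : Circle} {q : S1S3}
    (hq : q ∈ argDomain z) (v : TangentSpace mdl q) :
    mvfderiv mdl (conformalFactor h z) q v = -(circleFun h q * coform 0 q v) := by
  have h1 := mvfderiv_real_comp ((hasDerivAt_primitive h_smooth (localArg z q)).const_mul (-1))
    ((contMDiffAt_localArg hq).mdifferentiableAt (by simp)) v
  rw [mvfderiv_localArg hq, ← circleFun_eq_localArg h_periodic] at h1
  refine h1.trans (by ring)

lemma isLocalConformalFactor_conformalFactor (hR : ∀ p, 0 < reG a b p)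
    (h_smooth : ContDiff ℝ ∞ h) (h_periodic : Function.Periodic h (2 * Real.pi)) (z : Circle) :
    IsLocalConformalFactor mdl (J a b) (metric a b h) (argDomain z) (conformalFactor h z) := by
  refine ⟨isOpen_argDomain z,
    fun q hq ↦ (contMDiffAt_conformalFactor h_smooth hq).contMDiffWithinAt,
    fun X Y Z hX hY hZ q hq ↦ ?_⟩
  rw [extDerivTwo_exp_mul_fundamentalForm hR h_smooth h_periodic
    ((contMDiffAt_conformalFactor h_smooth hq).mdifferentiableAt (by simp)) hX hY hZ]
  simp only [mvfderiv_conformalFactor h_smooth h_periodic hq]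
  ring

end HopfMetric

namespace HopfMetric

open LCK Bundle

variable {a b : ℂ}

/-- The map `(t, x) ↦ e^{tc/2π} L x`. -/
noncomputable def expMul (c : ℂ) (L : R4 →L[ℝ] ℂ) (y : ℝ × R4) : ℂ :=
  Complex.exp (y.1 * (c / (2 * Real.pi))) * L y.2

lemma contDiff_expMul (c : ℂ) (L : R4 →L[ℝ] ℂ) : ContDiff ℝ ∞ (expMul c L) := by
  have h1 : ContDiff ℝ ∞ (fun y : ℝ × R4 ↦ Complex.exp (y.1 * (c / (2 * Real.pi)))) :=
    (Complex.contDiff_exp (𝕜 := ℝ)).comp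
      ((Complex.ofRealCLM.contDiff.comp contDiff_fst).mul contDiff_const)
  exact h1.mul (L.contDiff.comp contDiff_snd)

lemma fderiv_expMul (c : ℂ) (L : R4 →L[ℝ] ℂ) (y w : ℝ × R4) :
    fderiv ℝ (expMul c L) y w = c / (2 * Real.pi) * Complex.exp (y.1 * (c / (2 * Real.pi)))
      * L y.2 * w.1 + Complex.exp (y.1 * (c / (2 * Real.pi))) * L w.2 := by
  have h1 : HasFDerivAt (fun y : ℝ × R4 ↦ (y.1 : ℂ) * (c / (2 * Real.pi)))
      ((Complex.ofRealCLM.comp (ContinuousLinearMap.fst ℝ ℝ R4)).smulRight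
        (c / (2 * Real.pi) : ℂ)) y :=
    ((Complex.ofRealCLM.comp (ContinuousLinearMap.fst ℝ ℝ R4)).smulRight
      (c / (2 * Real.pi) : ℂ)).hasFDerivAt
  have h2 := h1.cexp.mul (L.comp (ContinuousLinearMap.snd ℝ ℝ R4)).hasFDerivAt
  have h3 : fderiv ℝ (expMul c L) y = _ := h2.fderiv
  rw [h3]
  simp
  ring

/-- The linear coordinate `ξ₁` of `ℂ²`. -/
noncomputable def xiCLM1 : R4 →L[ℝ] ℂ :=
  Complex.ofRealCLM.comp (EuclideanSpace.proj 0)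
    + (Complex.ofRealCLM.comp (EuclideanSpace.proj 1)).smulRight Complex.I

/-- The linear coordinate `ξ₂` of `ℂ²`. -/
noncomputable def xiCLM2 : R4 →L[ℝ] ℂ :=
  Complex.ofRealCLM.comp (EuclideanSpace.proj 2)
    + (Complex.ofRealCLM.comp (EuclideanSpace.proj 3)).smulRight Complex.I

lemma xiCLM1_apply (x : R4) : xiCLM1 x = ⟨x 0, x 1⟩ := by
  apply Complex.ext <;> simp [xiCLM1]

lemma xiCLM2_apply (x : R4) : xiCLM2 x = ⟨x 2, x 3⟩ := by
  apply Complex.ext <;> simp [xiCLM2]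

variable (a b) in
/-- The local coordinates of `S¹ × S³` given by the covering map of the Hopf surface. -/
noncomputable def hopfChart (z : Circle) (q : S1S3) : Fin 2 → ℂ :=
  ![expMul a xiCLM1 (localArg z q, (q.2 : R4)), expMul b xiCLM2 (localArg z q, (q.2 : R4))]

lemma contMDiffAt_localArg_prod {z : Circle} {q : S1S3} (hq : q ∈ argDomain z) :
    ContMDiffAt mdl 𝓘(ℝ, ℝ × R4) ∞ (fun q ↦ (localArg z q, (q.2 : R4))) q :=
  (contMDiffAt_localArg hq).prodMk_space (contMDiff_sphere q)

lemma contMDiffAt_hopfChart {z : Circle} {q : S1S3} (hq : q ∈ argDomain z) :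
    ContMDiffAt mdl 𝓘(ℝ, Fin 2 → ℂ) ∞ (hopfChart a b z) q := by
  rw [contMDiffAt_pi_space]
  intro i
  fin_cases i
  · exact (contDiff_expMul a xiCLM1).contMDiff.contMDiffAt.comp q (contMDiffAt_localArg_prod hq)
  · exact (contDiff_expMul b xiCLM2).contMDiff.contMDiffAt.comp q (contMDiffAt_localArg_prod hq)

lemma mvfderiv_hopfChart {z : Circle} {q : S1S3} (hq : q ∈ argDomain z) (v : TangentSpace mdl q) :
    mvfderiv mdl (hopfChart a b z) q v = dF a b (localArg z q) q v := by
  have hΦ := contMDiffAt_localArg_prod hq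
  have hd : mvfderiv mdl (fun q ↦ (localArg z q, (q.2 : R4))) q v
      = (coframe q v 0, dSphere q v) := by
    have h1 := mvfderiv_clm_comp (ContinuousLinearMap.fst ℝ ℝ R4)
      (hΦ.mdifferentiableAt (by simp)) v
    have h2 := mvfderiv_clm_comp (ContinuousLinearMap.snd ℝ ℝ R4)
      (hΦ.mdifferentiableAt (by simp)) v
    refine Prod.ext (h1.symm.trans ?_) h2.symm
    exact (mvfderiv_localArg hq v).trans (coform_apply 0 q v)
  have hc : ∀ (c : ℂ) (L : R4 →L[ℝ] ℂ),
      mvfderiv mdl (fun q ↦ expMul c L (localArg z q, (q.2 : R4))) q v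
        = c / (2 * Real.pi) * Complex.exp (localArg z q * (c / (2 * Real.pi))) * L q.2
            * coframe q v 0
          + Complex.exp (localArg z q * (c / (2 * Real.pi))) * L (dSphere q v) := by
    intro c L
    have h1 := mvfderiv_fderiv_comp
      ((contDiff_expMul c L).differentiable (by simp) (localArg z q, (q.2 : R4))).hasFDerivAt
      (hΦ.mdifferentiableAt (by simp)) v
    rw [hd, fderiv_expMul] at h1
    exact h1
  ext i
  have h1 := mvfderiv_clm_comp (ContinuousLinearMap.proj (R := ℝ) (φ := fun _ : Fin 2 ↦ ℂ) i)
    ((contMDiffAt_hopfChart (a := a) (b := b) hq).mdifferentiableAt (by simp)) v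
  refine h1.symm.trans ?_
  fin_cases i
  · refine (hc a xiCLM1).trans ?_
    rw [xiCLM1_apply, xiCLM1_apply]
    simp [dF, xi1, mul_div_assoc]
  · refine (hc b xiCLM2).trans ?_
    rw [xiCLM2_apply, xiCLM2_apply]
    simp [dF, xi2, mul_div_assoc]

lemma dF_injective (hR : ∀ p, 0 < reG a b p) (θ : ℝ) {p : S1S3} {v : TangentSpace mdl p}
    (hv : dF a b θ p v = 0) : v = 0 := by
  have hπ : (Real.pi : ℂ) ≠ 0 := by exact_mod_cast Real.pi_ne_zero
  rw [← sum_coframe_smul_frame p v, dF_sum_smul] at hv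
  have h1 := congrFun hv 0
  have h2 := congrFun hv 1
  simp only [Matrix.cons_val_zero, Matrix.cons_val_one, Pi.zero_apply, mul_eq_zero,
    Complex.exp_ne_zero, false_or] at h1 h2
  have hn : (starRingEnd ℂ) (xi1 p) * xi1 p + (starRingEnd ℂ) (xi2 p) * xi2 p = 1 := by
    rw [Complex.conj_mul', Complex.conj_mul']
    norm_cast
    rw [norm_xi1_sq, norm_xi2_sq]
    ring
  have hG : G a b p = (starRingEnd ℂ) (xi1 p) * xi1 p * a
      + (starRingEnd ℂ) (xi2 p) * xi2 p * b := by
    simp only [G, Complex.conj_mul']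
    push_cast
    ring
  have h3 : G a b p * coframe p v 0 / (2 * Real.pi) + Complex.I * coframe p v 1 = 0 := by
    rw [hG]
    linear_combination (starRingEnd ℂ) (xi1 p) * h1 + (starRingEnd ℂ) (xi2 p) * h2
      - Complex.I * coframe p v 1 * hn
  have h4 : G a b p * coframe p v 0 + Complex.I * coframe p v 1 * (2 * Real.pi) = 0 := by
    field_simp at h3
    linear_combination h3
  have hc0 : coframe p v 0 = 0 := by
    have h5 := congrArg Complex.re h4
    simp [G_re] at h5
    exact h5.resolve_left (hR p).ne'
  have hc1 : coframe p v 1 = 0 := by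
    have h5 := congrArg Complex.im h4
    rw [hc0] at h5
    simpa [Real.pi_ne_zero] using h5
  have hz : (coframe p v 2 + coframe p v 3 * Complex.I : ℂ) = 0 := by
    rw [hc0, hc1] at h1 h2
    simp only [Complex.ofReal_zero, mul_zero, zero_add, zero_sub] at h1 h2
    linear_combination -xi2 p * h1 + xi1 p * h2
      - (coframe p v 2 + coframe p v 3 * Complex.I) * hn
  have hc2 : coframe p v 2 = 0 := by simpa using congrArg Complex.re hz
  have hc3 : coframe p v 3 = 0 := by simpa using congrArg Complex.im hz
  rw [← sum_coframe_smul_frame p v, Fin.sum_univ_four, hc0, hc1, hc2, hc3]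
  simp

lemma isComplexStructure_J (hR : ∀ p, 0 < reG a b p) : IsComplexStructure mdl 2 (J a b) := by
  intro p
  refine ⟨argDomain p.1, isOpen_argDomain _, mem_argDomain p, hopfChart a b p.1,
    fun q hq ↦ (contMDiffAt_hopfChart hq).contMDiffWithinAt, fun q hq ↦ ⟨?_, fun v ↦ ?_⟩⟩
  · have hinj : Function.Injective (mvfderiv mdl (hopfChart a b p.1) q) := by
      rw [injective_iff_map_eq_zero]
      intro v hv
      rw [mvfderiv_hopfChart hq] at hv
      exact dF_injective hR _ hv
    have : FiniteDimensional ℝ (TangentSpace mdl q) := inferInstanceAs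
      (FiniteDimensional ℝ (EuclideanSpace ℝ (Fin 1) × EuclideanSpace ℝ (Fin 3)))
    have hfr : Module.finrank ℝ (TangentSpace mdl q) = Module.finrank ℝ (Fin 2 → ℂ) := by
      change Module.finrank ℝ (EuclideanSpace ℝ (Fin 1) × EuclideanSpace ℝ (Fin 3)) = _
      rw [Module.finrank_pi_fintype]
      simp
    exact ⟨hinj, (LinearMap.injective_iff_surjective_of_finrank_eq_finrank
      (f := (mvfderiv mdl (hopfChart a b p.1) q).toLinearMap) hfr).1 hinj⟩
  · rw [mvfderiv_hopfChart hq, mvfderiv_hopfChart hq]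
    exact dF_J a b _ q (by rw [G_re]; exact (hR q).ne') v

end HopfMetric

namespace HopfMetric

open LCK Bundle

variable {a b : ℂ} {h : ℝ → ℝ}

lemma isLCK_hopf (hR : ∀ p, 0 < reG a b p) (h_smooth : ContDiff ℝ ∞ h) (h_pos : ∀ t, 0 < h t)
    (h_periodic : Function.Periodic h (2 * Real.pi)) : IsLCK mdl 2 (J a b) (metric a b h) := by
  refine ⟨⟨isComplexStructure_J hR, ?_, metric_J_J h hR⟩, fun p ↦ ⟨argDomain p.1,
    conformalFactor h p.1, mem_argDomain p,
    isLocalConformalFactor_conformalFactor hR h_smooth h_periodic p.1⟩⟩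
  rw [metric_eq_sum h hR]
  have hs := contMDiff_circleFun h_smooth h_periodic
  refine (isGlobalCoframe_hopf hR).isRiemannianMetric (fun i ↦ ?_) (fun i p ↦ ?_)
  · fin_cases i
    · have := hs.mul (contMDiff_const (c := (4 * Real.pi)⁻¹))
      simpa only [div_eq_mul_inv] using! this
    · exact contMDiff_const.mul hs
    · exact contMDiff_const
    · exact contMDiff_const
  · have h1 : 0 < circleFun h p := h_pos _
    have hπ := Real.pi_pos
    fin_cases i
    · exact div_pos h1 (by positivity)
    · exact mul_pos hπ h1
    · exact one_pos
    · exact one_pos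

lemma coform_zero_hopfFrame (i : Fin 4) (p : S1S3) :
    coform 0 p (hopfFrame a b i p) = if 0 = i then 1 else 0 := by
  rw [coform_hopfFrame]
  fin_cases i <;> simp [hopfFrameCoeff]

/-- The values on `hopfFrame` of the fundamental form. -/
lemma metric_J_hopfFrame (hR : ∀ p, 0 < reG a b p) (p : S1S3) (i j : Fin 4) :
    metric a b h p (J a b p (hopfFrame a b i p)) (hopfFrame a b j p) =
      !![0, circleFun h p / 2, 0, 0; -(circleFun h p / 2), 0, 0, 0; 0, 0, 0, 1; 0, 0, -1, 0] i j := by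
  have h1 : (reG a b p)⁻¹ * (√(reG a b p) * √(reG a b p)) = 1 := by
    rw [Real.mul_self_sqrt (hR p).le, inv_mul_cancel₀ (hR p).ne']
  rw [metric_J_left h hR, yRe_hopfFrame hR, yRe_hopfFrame hR, yIm_hopfFrame hR, yIm_hopfFrame hR,
    tau_hopfFrame hR, tau_hopfFrame hR, coform_zero_hopfFrame, coform_zero_hopfFrame]
  fin_cases i <;> fin_cases j <;> simp [h1]

lemma isLeeForm_eq (hR : ∀ p, 0 < reG a b p) (h_smooth : ContDiff ℝ ∞ h) (h_pos : ∀ t, 0 < h t)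
    (h_periodic : Function.Periodic h (2 * Real.pi)) {η : Π p : S1S3, TangentSpace mdl p →L[ℝ] ℝ}
    (hη : IsLeeForm mdl (J a b) (metric a b h) η) (p : S1S3) (v : TangentSpace mdl p) :
    η p v = -(circleFun h p * coform 0 p v) := by
  obtain ⟨U, f, hp, ⟨hU, hf, hcl⟩, hηf⟩ := hη p
  have hfp : MDifferentiableAt mdl 𝓘(ℝ, ℝ) f p :=
    (hf.contMDiffAt (hU.mem_nhds hp)).mdifferentiableAt (by simp)
  have hE := isSmoothField_hopfFrame hR
  have key : ∀ i j k, (η p (hopfFrame a b i p) + circleFun h p * coform 0 p (hopfFrame a b i p))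
        * metric a b h p (J a b p (hopfFrame a b j p)) (hopfFrame a b k p)
      + (η p (hopfFrame a b j p) + circleFun h p * coform 0 p (hopfFrame a b j p))
        * metric a b h p (J a b p (hopfFrame a b k p)) (hopfFrame a b i p)
      + (η p (hopfFrame a b k p) + circleFun h p * coform 0 p (hopfFrame a b k p))
        * metric a b h p (J a b p (hopfFrame a b i p)) (hopfFrame a b j p) = 0 := by
    intro i j k
    have h1 := hcl _ _ _ (hE i) (hE j) (hE k) p hp
    rw [extDerivTwo_exp_mul_fundamentalForm hR h_smooth h_periodic hfp (hE i) (hE j) (hE k),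
      ← hηf p hp, neg_eq_zero] at h1
    exact (mul_eq_zero.1 h1).resolve_left (Real.exp_pos _).ne'
  have hh : circleFun h p / 2 ≠ 0 := (half_pos (h_pos _)).ne'
  have hz : ∀ i, η p (hopfFrame a b i p) + circleFun h p * coform 0 p (hopfFrame a b i p) = 0 := by
    intro i
    fin_cases i
    · have := key 0 2 3
      simp only [metric_J_hopfFrame hR] at this
      simpa using this
    · have := key 1 2 3
      simp only [metric_J_hopfFrame hR] at this
      simpa using this
    · have := key 2 0 1
      simp only [metric_J_hopfFrame hR] at this
      simpa [hh] using this
    · have := key 3 0 1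
      simp only [metric_J_hopfFrame hR] at this
      simpa [hh] using this
  have hL : η p + circleFun h p • coform 0 p = 0 := by
    ext w
    rw [← (isGlobalCoframe_hopf hR).sum_smul p w, map_sum]
    refine Finset.sum_eq_zero fun i _ ↦ ?_
    rw [map_smul]
    exact smul_eq_zero_of_right _ (hz i)
  have h2 := congrArg (fun K ↦ K v) hL
  exact eq_neg_of_add_eq_zero_left h2

lemma metric_hopfFrame_zero (hR : ∀ p, 0 < reG a b p) (p : S1S3) (w : TangentSpace mdl p) :
    metric a b h p (hopfFrame a b 0 p) w = circleFun h p / (4 * Real.pi) * coform 0 p w := by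
  rw [metric_eq h hR, tau_hopfFrame hR, yRe_hopfFrame hR, yIm_hopfFrame hR, coform_zero_hopfFrame]
  simp

lemma metric_comm (hR : ∀ p, 0 < reG a b p) (p : S1S3) (v w : TangentSpace mdl p) :
    metric a b h p v w = metric a b h p w v := by
  rw [metric_eq h hR, metric_eq h hR]
  ring

lemma deriv_eq_zero_of_isVaisman (hR : ∀ p, 0 < reG a b p) (h_smooth : ContDiff ℝ ∞ h)
    (h_pos : ∀ t, 0 < h t) (h_periodic : Function.Periodic h (2 * Real.pi))
    (hV : IsVaisman mdl 2 (J a b) (metric a b h)) (p : S1S3) :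
    deriv h (Complex.arg p.1) = 0 := by
  obtain ⟨-, η, hη, nabla, hLC, hpar⟩ := hV
  have hE := isSmoothField_hopfFrame hR 0
  have hs : MDifferentiableAt mdl 𝓘(ℝ, ℝ) (circleFun h) p :=
    (contMDiff_circleFun h_smooth h_periodic).mdifferentiable (by simp) p
  have hT : ∀ q, coform 0 q (hopfFrame a b 0 q) = 1 := fun q ↦ by
    rw [coform_zero_hopfFrame, if_pos rfl]
  have h1 := hpar _ _ hE hE p
  have h2 : (fun q ↦ η q (hopfFrame a b 0 q)) = fun q ↦ -1 * circleFun h q := by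
    ext q
    rw [isLeeForm_eq hR h_smooth h_pos h_periodic hη, hT]
    ring
  rw [h2, mvfderiv_const_mul_apply _ hs, isLeeForm_eq hR h_smooth h_pos h_periodic hη,
    mvfderiv_circleFun h_smooth h_periodic, hT] at h1
  have h3 := hLC.metric _ _ _ hE hE hE p
  have h4 : (fun q ↦ metric a b h q (hopfFrame a b 0 q) (hopfFrame a b 0 q))
      = fun q ↦ (4 * Real.pi)⁻¹ * circleFun h q := by
    ext q
    rw [metric_hopfFrame_zero hR, hT]
    ring
  rw [h4, mvfderiv_const_mul_apply _ hs, mvfderiv_circleFun h_smooth h_periodic, hT,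
    metric_comm hR, metric_hopfFrame_zero hR] at h3
  have hπ := Real.pi_ne_zero
  field_simp at h3
  linarith

lemma exists_const_of_isVaisman (hR : ∀ p, 0 < reG a b p) (h_smooth : ContDiff ℝ ∞ h)
    (h_pos : ∀ t, 0 < h t) (h_periodic : Function.Periodic h (2 * Real.pi))
    (hV : IsVaisman mdl 2 (J a b) (metric a b h)) : ∃ c, ∀ t, h t = c := by
  have hQ : (EuclideanSpace.single 0 1 : R4) ∈ Metric.sphere (0 : R4) 1 := by simp
  have hd : ∀ t, deriv h t = 0 := by
    intro t
    have hp : Function.Periodic (deriv h) (2 * Real.pi) := by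
      intro s
      rw [← deriv_comp_add_const]
      congr 1
      exact funext h_periodic
    obtain ⟨s, hs, hts⟩ := hp.exists_mem_Ioc Real.two_pi_pos t (-Real.pi)
    have h1 := deriv_eq_zero_of_isVaisman hR h_smooth h_pos h_periodic hV
      (Circle.exp s, ⟨_, hQ⟩)
    rw [Circle.arg_exp hs.1 (by linarith [hs.2])] at h1
    rw [hts, h1]
  exact ⟨h 0, fun t ↦ is_const_of_deriv_eq_zero (h_smooth.differentiable (by simp)) hd t 0⟩

lemma hopfCoframeDeriv_frame_zero (hR : ∀ p, 0 < reG a b p) (k : Fin 4) (p : S1S3)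
    (v : TangentSpace mdl p) : hopfCoframeDeriv a b k p (hopfFrame a b 0 p) v =
      (![0, 0, (a.im + b.im) / (2 * Real.pi) * hopfCoframe a b 3 p v,
        -((a.im + b.im) / (2 * Real.pi) * hopfCoframe a b 2 p v)] : Fin 4 → ℝ) k := by
  have hπ := Real.pi_ne_zero
  have c0 : coform 0 p (hopfFrame a b 0 p) = 1 := coform_hopfFrame 0 0 p
  have c1 : coform 1 p (hopfFrame a b 0 p) = -1 * imG a b p := coform_hopfFrame 0 1 p
  have c2 : coform 2 p (hopfFrame a b 0 p) = -slope a b * prodIm p := coform_hopfFrame 0 2 p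
  have c3 : coform 3 p (hopfFrame a b 0 p) = slope a b * prodRe p := coform_hopfFrame 0 3 p
  have ht : tau a b p (hopfFrame a b 0 p) = 0 := tau_hopfFrame hR 0 p
  have hy : yRe a b p (hopfFrame a b 0 p) = 0 := yRe_hopfFrame hR 0 p
  have hz : yIm a b p (hopfFrame a b 0 p) = 0 := yIm_hopfFrame hR 0 p
  have hr : mvfderiv mdl (invSqrtG a b) p (hopfFrame a b 0 p) = 0 := by
    refine mvfderiv_invSqrtG_eq_zero hR ?_
    rw [mvfderiv_modSq, c2, c3]
    ring
  have hs : slope a b = (a.im - b.im) / (2 * Real.pi) := rfl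
  have hk : -2 * imG a b p + (2 * modSq p - 1) * slope a b = -((a.im + b.im) / (2 * Real.pi)) := by
    rw [imG, hs]
    field_simp
    ring
  fin_cases k
  · rfl
  · change 2 * (reG a b p)⁻¹ * (_ - _) = (0 : ℝ)
    rw [hy, hz]
    ring
  · change invSqrtG a b p * (2 * (_ - _) + _ * (_ - _) - _ * (_ - _) - _ * (_ * (_ - _)))
      + (_ - _) = _ * (invSqrtG a b p * yIm a b p v)
    simp only [c0, c1, c3, ht, hy, hz, hr, mvfderiv_prodIm, yIm_apply]
    linear_combination invSqrtG a b p * (slope a b * prodRe p * coform 0 p v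
      - (a.re - b.re) * prodRe p * tau a b p v - coform 3 p v) * hk
  · change invSqrtG a b p * (2 * (_ - _) - _ * (_ - _) + _ * (_ - _) + _ * (_ * (_ - _)))
      + (_ - _) = -(_ * (invSqrtG a b p * yRe a b p v))
    simp only [c0, c1, c2, ht, hy, hz, hr, mvfderiv_prodRe, yRe_apply]
    linear_combination invSqrtG a b p * (slope a b * prodIm p * coform 0 p v
      - (a.re - b.re) * prodIm p * tau a b p v + coform 2 p v) * hk

lemma christoffel_hopf_zero (hR : ∀ p, 0 < reG a b p) {w : Fin 4 → ℝ} (hw : w 2 = w 3)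
    (i j : Fin 4) (p : S1S3) :
    IsGlobalCoframe.christoffel (hopfCoframeDeriv a b) (hopfFrame a b) w 0 i j p = 0 := by
  have h0 : ∀ v v', hopfCoframeDeriv a b 0 p v v' = 0 := fun _ _ ↦ rfl
  rw [IsGlobalCoframe.christoffel, (isGlobalCoframe_hopf hR).extDeriv_swap i j 0, h0,
    hopfCoframeDeriv_frame_zero hR, hopfCoframeDeriv_frame_zero hR]
  simp only [hopfCoframe_hopfFrame hR]
  fin_cases i <;> fin_cases j <;> simp [hw]

lemma isVaisman_hopf (hR : ∀ p, 0 < reG a b p) (h_smooth : ContDiff ℝ ∞ h)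
    (h_pos : ∀ t, 0 < h t) (h_periodic : Function.Periodic h (2 * Real.pi)) {c : ℝ}
    (hc : ∀ t, h t = c) : IsVaisman mdl 2 (J a b) (metric a b h) := by
  have hc0 : 0 < c := hc 0 ▸ h_pos 0
  have hπ := Real.pi_pos
  refine ⟨isLCK_hopf hR h_smooth h_pos h_periodic, fun p ↦ (-1 * circleFun h p) • coform 0 p,
    fun p ↦ ⟨argDomain p.1, conformalFactor h p.1, mem_argDomain p,
      isLocalConformalFactor_conformalFactor hR h_smooth h_periodic p.1, fun q hq ↦ ?_⟩, ?_⟩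
  · ext v
    rw [mvfderiv_conformalFactor h_smooth h_periodic hq, smul_apply, smul_eq_mul]
    ring
  · have hcf : ∀ p, circleFun h p = c := fun p ↦ hc _
    let w : Fin 4 → ℝ := ![c / (4 * Real.pi), Real.pi * c, 1, 1]
    have hw : ∀ i, w i ≠ 0 := by
      intro i
      fin_cases i
      · exact (div_pos hc0 (by positivity)).ne'
      · exact (mul_pos hπ hc0).ne'
      · exact one_ne_zero
      · exact one_ne_zero
    have hm : metric a b h = fun p v v' ↦
        ∑ i, w i * (hopfCoframe a b i p v * hopfCoframe a b i p v') := by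
      rw [metric_eq_sum h hR]
      ext p v v'
      refine Finset.sum_congr rfl fun i _ ↦ ?_
      congr 1
      fin_cases i
      · exact congrArg (· / (4 * Real.pi)) (hcf p)
      · exact congrArg (Real.pi * ·) (hcf p)
      · rfl
      · rfl
    obtain ⟨nabla, hLC, hnabla⟩ := (isGlobalCoframe_hopf hR).exists_isLeviCivita hw
    refine ⟨nabla, hm ▸ hLC, fun X Y hX hY p ↦ ?_⟩
    have h1 := hnabla Y p (X p) 0
    simp only [christoffel_hopf_zero hR (w := w) rfl, mul_zero, Finset.sum_const_zero,
      add_zero] at h1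
    have h2 : coform 0 p (nabla Y p (X p)) = mvfderiv mdl (fun q ↦ coform 0 q (Y q)) p (X p) := h1
    have h3 := mvfderiv_const_mul_apply (-1 * c)
      (hasExtDeriv_coform_zero.mdifferentiableAt Y p (hY.mdifferentiable (by simp) p)) (X p)
    simp only [smul_apply, smul_eq_mul, hcf, h2]
    rw [h3, sub_self]

end HopfMetric

theorem mainTheorem5 (α β a b : ℂ) (hβ : 1 < ‖β‖) (hαβ : ‖β‖ ≤ ‖α‖)
    (ha : Complex.exp a = α) (hb : Complex.exp b = β)
    (h : ℝ → ℝ) (h_smooth : ContDiff ℝ ∞ h) (h_pos : ∀ t, 0 < h t)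
    (h_periodic : Function.Periodic h (2 * Real.pi)) :
    LCK.IsLCK HopfMetric.mdl 2 (HopfMetric.J a b) (HopfMetric.metric a b h) ∧
      (LCK.IsVaisman HopfMetric.mdl 2 (HopfMetric.J a b) (HopfMetric.metric a b h) ↔
        ∃ c : ℝ, ∀ t : ℝ, h t = c) := by
  have ha0 : 0 < a.re := by
    rw [← ha, Complex.norm_exp] at hαβ
    exact Real.one_lt_exp_iff.1 (hβ.trans_le hαβ)
  have hb0 : 0 < b.re := by
    rw [← hb, Complex.norm_exp] at hβ
    exact Real.one_lt_exp_iff.1 hβ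
  have hR := HopfMetric.reG_pos ha0 hb0
  exact ⟨HopfMetric.isLCK_hopf hR h_smooth h_pos h_periodic,
    HopfMetric.exists_const_of_isVaisman hR h_smooth h_pos h_periodic,
    fun ⟨_, hc⟩ ↦ HopfMetric.isVaisman_hopf hR h_smooth h_pos h_periodic hc⟩
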